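/- A polytope $P$ is the convex hull of a finite set of points in a Euclidean space; faces (including $\emptyset$, of dimension $-1$, and $P$), dimension, vertices, edges, facets and the graph of a polytope are as usual. A treetope with base $B$ is a polytope $P$ with a facet $B$ such that every face of $P$ that meets $B$ in at most one point has dimension at most one. Its canopy is the graph (a tree) formed by the vertices of $P$ and the edges of $P$ that meet $B$ in at most one point. Let $uv$ be an edge of $P$ with $u,v\notin B$. Deleting $uv$ from the canopy splits the vertices of $P$ into two sets: the branch $U$ of the vertices in the subtree containing $u$, and the branch $V$ of those in the subtree containing $v$. The pair $(U,V)$ is the slice defined by $uv$. The stems of $U$ are the following subsets of $U$, one for each edge $uw$ of $P$ with $w\neq v$: the set $\{w\}$ if $w\in B$, and otherwise the branch containing $w$ of the slice defined by the edge $uw$. The stems of $V$ are defined symmetrically. A graph is $k$-vertex-connected if it has more than $k$ vertices and remains connected after the deletion of any set of fewer than $k$ vertices. A set $S$ of vertices of $B$ is externally $k$-vertex-connected if the graph formed from the graph of $B$ by contracting all vertices of $B$ outside $S$ into a single supervertex is $k$-vertex-connected. **Theorem.** Let $P$ be a treetope with base $B$, let $d=\dim P$, and let $(U,V)$ be a slice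 of $P$. Then: 1. Both $U$ and $V$ have at least $d-1$ stems. 2. For any two distinct sets $X,Y$, each of which is a stem of $U$ or the set $V$, there is at most one edge of $B$ with one endpoint in $X$ and the other in $Y$; likewise when each of $X,Y$ is a stem of $V$ or the set $U$. 3. Both $U\cap B$ and $V\cap B$ are externally $(d-1)$-vertex-connected. -/

import Mathlib

noncomputable section

namespace Treetope

/-! ### Graph notions -/

section Graphs

variable {W : Type*}

/-- `k`-vertex-connectivity: there are more than `k` vertices, and deleting any set of fewer than
`k` vertices leaves a connected graph. -/
def IsKVertexConnected (G : SimpleGraph W) (k : ℕ) : Prop :=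
  (k : ℕ∞) < ENat.card W ∧ ∀ K : Set W, K.encard < k → (G.induce Kᶜ).Connected

open Classical in
/-- The map that fixes the elements of `S` and sends everything else to one extra point. -/
def collapse (S : Set W) (x : W) : Option W :=
  if x ∈ S then some x else none

/-- The simple graph formed from `G` by contracting all vertices outside `S` into a single
supervertex `none` (which is present exactly when there is a vertex outside `S`): its vertices are
the images of the vertices of `G` under `collapse S`, and two different ones are adjacent iff some
edge of `G` joins their preimages. -/
def contractOutside (G : SimpleGraph W) (S : Set W) :
    SimpleGraph (Set.range (collapse S)) :=
  G.map (Set.rangeFactorization (collapse S))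

end Graphs

/-! ### Polytopes -/

section Polytopes

variable {E : Type*} [NormedAddCommGroup E] [InnerProductSpace ℝ E]

/-- A polytope is the convex hull of a finite set of points. -/
def IsPolytope (P : Set E) : Prop :=
  ∃ S : Set E, S.Finite ∧ P = convexHull ℝ S

/-- The faces of a polytope `P`: the subsets where a linear functional attains its maximum over `P`,
together with the empty set (`P` itself is the face of the zero functional). -/
def IsFace (P F : Set E) : Prop :=
  IsExposed ℝ P F

open Classical in
/-- The dimension of a face: the dimension of its affine hull, and `-1` for the empty set. -/
def dim (F : Set E) : ℤ :=
  if F.Nonempty then (Module.finrank ℝ (affineSpan ℝ F).direction : ℤ) else -1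

/-- A facet is a face of dimension one less than that of the polytope. -/
def IsFacet (P F : Set E) : Prop :=
  IsFace P F ∧ dim F = dim P - 1

/-- The vertices of `P`: the points that are faces of `P`. -/
def vertices (P : Set E) : Set E :=
  {x | IsFace P {x}}

/-- The graph (`1`-skeleton) of `P`: two distinct vertices are adjacent iff the segment between them
is a face of `P`. -/
def graph (P : Set E) : SimpleGraph (vertices P) where
  Adj x y := x ≠ y ∧ IsFace P (segment ℝ (x : E) (y : E))
  symm := ⟨fun x y h => ⟨h.1.symm, by rw [segment_symm]; exact h.2⟩⟩
  loopless := ⟨fun _ h => h.1 rfl⟩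

/-! ### Treetopes, branches, slices and stems -/

/-- `P` is a treetope with base `B`: `B` is a facet of the polytope `P`, and every face of `P` that
meets `B` in at most one point has dimension at most one. -/
structure IsTreetope (P B : Set E) : Prop where
  isPolytope : IsPolytope P
  isFacet : IsFacet P B
  dim_le_one : ∀ F : Set E, IsFace P F → (F ∩ B).Subsingleton → dim F ≤ 1

/-- The canopy of `P` with base `B`, as a graph on the vertices of `P`: its edges are the edges
of `P` that meet `B` in at most one point. -/
def canopy (P B : Set E) : SimpleGraph (vertices P) where
  Adj x y := (graph P).Adj x y ∧ (segment ℝ (x : E) (y : E) ∩ B).Subsingleton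
  symm := ⟨fun x y h => ⟨h.1.symm, by rw [segment_symm]; exact h.2⟩⟩
  loopless := ⟨fun _ h => h.1.ne rfl⟩

/-- The set of vertices of `P` that lie in the same part as `u` after the edge `uv` is deleted from
the canopy. -/
def branch (P B : Set E) (u v : vertices P) : Set E :=
  Subtype.val '' {x | ((canopy P B).deleteEdges {s(u, v)}).Reachable u x}

/-- `(U, V)` is the slice of `P` defined by the edge `uv`, which has no endpoint in `B`; `U` is the
branch containing `u`, and `V` is the branch containing `v`. -/
structure IsSlice (P B : Set E) (u v : vertices P) (U V : Set E) : Prop where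
  adj : (graph P).Adj u v
  left_notMem : (u : E) ∉ B
  right_notMem : (v : E) ∉ B
  left_eq : U = branch P B u v
  right_eq : V = branch P B v u

/-- `X` is the stem corresponding to the edge `uw`: it is `{w}` if `w` is in the base, and otherwise
it is the branch containing `w` of the slice defined by `uw`. -/
def IsStemAt (P B : Set E) (u w : vertices P) (X : Set E) : Prop :=
  ((w : E) ∈ B ∧ X = {(w : E)}) ∨ ((w : E) ∉ B ∧ X = branch P B w u)

/-- The stems of the branch containing `u` of the slice defined by `uv`: one for each edge `uw` of
`P` with `w ≠ v`. -/
def stems (P B : Set E) (u v : vertices P) : Set (Set E) :=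
  {X | ∃ w : vertices P, (graph P).Adj u w ∧ w ≠ v ∧ IsStemAt P B u w X}

/-- The edges of the polytope `B` with one endpoint in `X` and the other in `Y`. -/
def edgesBetween (B X Y : Set E) : Set (Sym2 (vertices B)) :=
  {e | e ∈ (graph B).edgeSet ∧ ∃ x y : vertices B, e = s(x, y) ∧ (x : E) ∈ X ∧ (y : E) ∈ Y}

/-- A set `S` of vertices of `B` is externally `k`-vertex-connected if the graph formed from the
graph of `B` by contracting all vertices outside `S` into a single supervertex is
`k`-vertex-connected. -/
def IsExternallyConnected (B S : Set E) (k : ℕ) : Prop :=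
  IsKVertexConnected (contractOutside (graph B) (Subtype.val ⁻¹' S)) k

end Polytopes

end Treetope

end

noncomputable section

namespace Treetope

open Set

section Basics

variable {E : Type*} [NormedAddCommGroup E] [InnerProductSpace ℝ E] {P F G : Set E}

/-! ### Faces of polytopes -/

/-! Fix a linear functional `f` whose minimum over `P` is attained exactly on `B`. For a vertex `u`
outside `B`, each neighbour `w` of `u` spans a side: the vertices still reachable from `w` after the
canopy edge `uw` is deleted. The stems of `U` together with `V` are exactly the sides at `u`. The
treetope axiom is used in one form: a face with three vertices meets `B` in more than one point
(`not_subsingleton`).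

The canopy is acyclic. Otherwise, for a generic perturbation of `f`, some vertex has two canopy
neighbours above it. They yield a face with three vertices that has this vertex as its lowest point,
so the face contains a base vertex above it, which is impossible. Hence the sides at `u` are
disjoint, and part 1 is the bound on the degree of a vertex.

For part 2, extend a base edge between two sides at `u` to a face meeting `B` only in that edge. The
canopy inside this face is connected, so the face contains `u` and the two neighbours concerned. Two
such faces share three vertices, hence more than a point of `B`, and the two base edges coincide
(`base_adj_unique`). Conversely, every edge of the vertex figure at `u` produces a base edge between
the corresponding sides (`exists_base_adj_of_link`).

For part 3, if the supervertex survives, Balinski's theorem for `B` suffices. If it is deleted,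
induct on the size of the branch (`reachable_side_sdiff`): stems untouched by the deletion are
connected inside and, by Balinski's theorem for the vertex figure, to each other. A surviving vertex
of any other stem reaches an untouched one, because too few vertices are deleted to block all base
edges leaving its stem. -/

theorem IsPolytope.convex (hP : IsPolytope P) : Convex ℝ P := by
  obtain ⟨S, -, rfl⟩ := hP
  exact convex_convexHull ℝ S

theorem IsPolytope.isCompact (hP : IsPolytope P) : IsCompact P := by
  obtain ⟨S, hS, rfl⟩ := hP
  exact hS.isCompact_convexHull ℝ

theorem isFace_setOf {l : E →L[ℝ] ℝ} {m : ℝ} (h : ∀ y ∈ P, l y ≤ m) :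
    IsFace P {x ∈ P | l x = m} := by
  rintro ⟨w, hw, hwm⟩
  refine ⟨l, Set.ext fun x => ⟨fun hx => ⟨hx.1, fun y hy => hx.2 ▸ h y hy⟩, fun hx => ⟨hx.1, ?_⟩⟩⟩
  exact le_antisymm (h x hx.1) (hwm ▸ hx.2 w hw)

theorem IsFace.exists_eq_setOf (hF : IsFace P F) (hne : F.Nonempty) :
    ∃ (l : E →L[ℝ] ℝ) (m : ℝ), (∀ y ∈ P, l y ≤ m) ∧ F = {x ∈ P | l x = m} := by
  obtain ⟨l, rfl⟩ := hF hne
  obtain ⟨w, hw, hwm⟩ := hne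
  exact ⟨l, l w, hwm, Set.ext fun x => ⟨fun hx => ⟨hx.1, le_antisymm (hwm x hx.1) (hx.2 w hw)⟩,
    fun hx => ⟨hx.1, fun y hy => hx.2 ▸ hwm y hy⟩⟩⟩

theorem IsFace.subset (hF : IsFace P F) : F ⊆ P := IsExposed.subset hF

theorem IsFace.inter (hF : IsFace P F) (hG : IsFace P G) : IsFace P (F ∩ G) :=
  IsExposed.inter hF hG

theorem IsFace.mono (hG : IsFace P G) (hF : IsFace P F) (h : G ⊆ F) : IsFace F G :=
  IsExposed.mono hG hF.subset h

theorem IsFace.isExtreme (hF : IsFace P F) : IsExtreme ℝ P F := IsExposed.isExtreme hF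

theorem IsPolytope.extremePoints_finite (hP : IsPolytope P) : (P.extremePoints ℝ).Finite := by
  obtain ⟨S, hS, rfl⟩ := hP
  exact hS.subset extremePoints_convexHull_subset

theorem convexHull_extremePoints_eq (hc : Convex ℝ P) (hk : IsCompact P)
    (hf : (P.extremePoints ℝ).Finite) : convexHull ℝ (P.extremePoints ℝ) = P := by
  rw [← (hf.isClosed_convexHull ℝ).closure_eq, closure_convexHull_extremePoints hk hc]

theorem IsPolytope.convexHull_extremePoints (hP : IsPolytope P) :
    convexHull ℝ (P.extremePoints ℝ) = P :=
  convexHull_extremePoints_eq hP.convex hP.isCompact hP.extremePoints_finite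

/-- An extreme point lies outside the hull of the other extreme points. That hull is closed, there
being finitely many of them, so Hahn-Banach separates strictly. -/
theorem IsPolytope.exists_lt_of_mem_extremePoints (hP : IsPolytope P) {x : E}
    (hx : x ∈ P.extremePoints ℝ) :
    ∃ l : E →L[ℝ] ℝ, ∀ y ∈ P, y ≠ x → l y < l x := by
  have hfin := hP.extremePoints_finite
  have hx' : x ∉ convexHull ℝ (P.extremePoints ℝ \ {x}) := fun h =>
    ((hP.convex.mem_extremePoints_iff_mem_sdiff_convexHull_sdiff).1 hx).2
      (convexHull_mono (sdiff_subset_sdiff_left extremePoints_subset) h)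
  obtain ⟨l, c, hl, hlx⟩ := geometric_hahn_banach_closed_point (convex_convexHull ℝ _)
    ((hfin.subset sdiff_subset).isClosed_convexHull ℝ) hx'
  refine ⟨l, fun y hy hyx => ?_⟩
  rw [← hP.convexHull_extremePoints] at hy
  rcases (P.extremePoints ℝ \ {x}).eq_empty_or_nonempty with h0 | hne
  · have : P.extremePoints ℝ ⊆ {x} := sdiff_eq_empty.1 h0
    have := convexHull_mono (𝕜 := ℝ) this hy
    rw [convexHull_singleton] at this
    exact absurd this hyx
  · rw [← insert_sdiff_self_of_mem hx, convexHull_insert hne, mem_convexJoin] at hy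
    obtain ⟨x', hx', z, hz, a, b, ha, hb, hab, hye⟩ := hy
    rw [mem_singleton_iff] at hx'
    rw [hx'] at hye
    have hb0 : b ≠ 0 := by
      rintro rfl
      rw [add_zero] at hab
      exact hyx (by simp [← hye, hab])
    have hb' : 0 < b := lt_of_le_of_ne hb hb0.symm
    have := hl z hz
    have e : l y = a * l x + b * l z := by simp [← hye]
    rw [e]
    have ha' : a = 1 - b := by linarith
    subst ha'
    nlinarith

theorem IsPolytope.vertices_eq (hP : IsPolytope P) : vertices P = P.extremePoints ℝ := by
  ext x
  refine ⟨fun h => (IsFace.isExtreme h).mem_extremePoints, fun hx => ?_⟩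
  obtain ⟨l, hl⟩ := hP.exists_lt_of_mem_extremePoints hx
  have := isFace_setOf (P := P) (l := l) (m := l x) fun y hy => by
    rcases eq_or_ne y x with rfl | h
    · exact le_rfl
    · exact (hl y hy h).le
  have e : {y ∈ P | l y = l x} = {x} := by
    ext y
    refine ⟨fun hy => ?_, ?_⟩
    · by_contra h
      exact (hl y hy.1 h).ne hy.2
    · rintro rfl
      exact ⟨hx.1, rfl⟩
  rwa [e] at this

theorem vertices_subset : vertices P ⊆ P := fun _ hx => IsFace.subset hx rfl

theorem IsPolytope.finite_vertices (hP : IsPolytope P) : (vertices P).Finite :=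
  hP.vertices_eq ▸ hP.extremePoints_finite

theorem IsPolytope.convexHull_vertices (hP : IsPolytope P) : convexHull ℝ (vertices P) = P := by
  rw [hP.vertices_eq, hP.convexHull_extremePoints]

theorem IsPolytope.nonempty_vertices (hP : IsPolytope P) (h : P.Nonempty) :
    (vertices P).Nonempty := by
  rw [← hP.convexHull_vertices] at h
  exact convexHull_nonempty_iff.1 h

theorem IsPolytope.exists_lt_of_mem_vertices (hP : IsPolytope P) {x : E} (hx : x ∈ vertices P) :
    ∃ l : E →L[ℝ] ℝ, ∀ y ∈ P, y ≠ x → l y < l x :=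
  hP.exists_lt_of_mem_extremePoints (hP.vertices_eq ▸ hx)

theorem IsPolytope.isPolytope_of_isFace (hP : IsPolytope P) (hF : IsFace P F) :
    IsPolytope F := by
  have hf : (F.extremePoints ℝ).Finite :=
    hP.extremePoints_finite.subset hF.isExtreme.extremePoints_subset_extremePoints
  exact ⟨_, hf, (convexHull_extremePoints_eq (IsExposed.convex hF hP.convex)
    (IsExposed.isCompact hF hP.isCompact) hf).symm⟩

theorem IsPolytope.vertices_of_isFace (hP : IsPolytope P) (hF : IsFace P F) :
    vertices F = F ∩ vertices P := by
  rw [(hP.isPolytope_of_isFace hF).vertices_eq, hP.vertices_eq, hF.isExtreme.extremePoints_eq]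

theorem IsPolytope.face_ext (hP : IsPolytope P) (hF : IsFace P F) (hG : IsFace P G)
    (h : ∀ x ∈ vertices P, x ∈ F ↔ x ∈ G) : F = G := by
  rw [← (hP.isPolytope_of_isFace hF).convexHull_vertices,
    ← (hP.isPolytope_of_isFace hG).convexHull_vertices, hP.vertices_of_isFace hF,
    hP.vertices_of_isFace hG]
  congr 1
  ext x
  exact ⟨fun hx => ⟨(h x hx.2).1 hx.1, hx.2⟩, fun hx => ⟨(h x hx.2).2 hx.1, hx.2⟩⟩

theorem IsPolytope.le_of_forall_vertices (hP : IsPolytope P) {l : E →L[ℝ] ℝ} {m : ℝ}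
    (h : ∀ y ∈ vertices P, l y ≤ m) {x : E} (hx : x ∈ P) : l x ≤ m := by
  rw [← hP.convexHull_vertices] at hx
  exact convexHull_min (t := {y | l y ≤ m}) h
    (convex_halfSpace_le l.toLinearMap.isLinear m) hx

theorem exists_pos_forall_lt_mul {ι : Type*} {s : Set ι} (hs : s.Finite) (a b : ι → ℝ) :
    ∃ t : ℝ, 0 < t ∧ ∀ i ∈ s, 0 < a i → b i < t * a i := by
  obtain ⟨c, hc⟩ := (hs.image fun i => b i / a i).bddAbove
  refine ⟨max c 0 + 1, by positivity, fun i hi ha => ?_⟩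
  have : b i / a i ≤ c := hc ⟨i, hi, rfl⟩
  rw [← div_lt_iff₀ ha]
  linarith [le_max_left c 0]

theorem IsPolytope.isFace_trans (hP : IsPolytope P) (hF : IsFace P F) (hG : IsFace F G) :
    IsFace P G := by
  rcases G.eq_empty_or_nonempty with rfl | hne
  · exact isExposed_empty
  have hFP := hP.isPolytope_of_isFace hF
  obtain ⟨l, m, hl, hFe⟩ := hF.exists_eq_setOf (hne.mono hG.subset)
  obtain ⟨k, n, hk, hGe⟩ := hG.exists_eq_setOf hne
  obtain ⟨t, ht, htv⟩ := exists_pos_forall_lt_mul hP.finite_vertices (fun w => m - l w)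
    (fun w => k w - n)
  have key : ∀ w ∈ vertices P, (t • l + k) w ≤ t * m + n ∧
      ((t • l + k) w = t * m + n ↔ w ∈ G) := by
    intro w hw
    have hwP := vertices_subset hw
    have e : (t • l + k) w = t * l w + k w := by simp
    rw [e]
    rcases (hl w hwP).lt_or_eq with h | h
    · have := htv w hw (sub_pos.2 h)
      refine ⟨by nlinarith, fun h' => ?_, fun h' => ?_⟩
      · nlinarith
      · have := hG.subset h'
        rw [hFe] at this
        exact absurd this.2 h.ne
    · have hwF : w ∈ F := by rw [hFe]; exact ⟨hwP, h⟩
      have := hk w hwF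
      rw [h]
      refine ⟨by linarith, fun h' => ?_, fun h' => ?_⟩
      · rw [hGe]; exact ⟨hwF, by linarith⟩
      · rw [hGe] at h'; rw [h'.2]
  have hG' := isFace_setOf (P := P) (l := t • l + k) (m := t * m + n)
    fun y hy => hP.le_of_forall_vertices (fun w hw => (key w hw).1) hy
  have hG'' : IsFace F ({x ∈ P | (t • l + k) x = t * m + n} ∩ F) :=
    (hG'.inter hF).mono hF inter_subset_right
  have : G = {x ∈ P | (t • l + k) x = t * m + n} ∩ F := by
    refine hFP.face_ext hG hG'' fun x hx => ?_
    rw [hP.vertices_of_isFace hF] at hx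
    exact ⟨fun h => ⟨⟨vertices_subset hx.2, (key x hx.2).2.2 h⟩, hx.1⟩,
      fun h => (key x hx.2).2.1 h.1.2⟩
  rw [this]
  exact hG'.inter hF

/-- If a face `e` lies in a proper face `B`, then it is the intersection of `B` with a face not
contained in `B`. -/
theorem IsPolytope.exists_isFace_inter_eq (hP : IsPolytope P) {B e : Set E} (hB : IsFace P B)
    (hPB : ¬ P ⊆ B) (he : IsFace P e) (heB : e ⊆ B) (hne : e.Nonempty) :
    ∃ F, IsFace P F ∧ F ∩ B = e ∧ ¬ F ⊆ B := by
  obtain ⟨f, β, hf, hBe⟩ := hB.exists_eq_setOf (hne.mono heB)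
  obtain ⟨l, m, hl, hee⟩ := he.exists_eq_setOf hne
  have hW : (vertices P \ B).Nonempty := by
    by_contra h
    rw [not_nonempty_iff_eq_empty, sdiff_eq_empty] at h
    apply hPB
    rw [← hP.convexHull_vertices]
    exact convexHull_min h (IsExposed.convex hB hP.convex)
  have hlt : ∀ w ∈ vertices P \ B, 0 < β - f w := fun w hw =>
    sub_pos.2 (lt_of_le_of_ne (hf w (vertices_subset hw.1)) fun h => hw.2 (by
      rw [hBe]; exact ⟨vertices_subset hw.1, h⟩))
  -- The minimal ratio is the largest `t` for which `l - t • f` still supports `P` with value `m - t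
  -- * β`. At this `t` the supported face picks up `w₀`, which is outside `B`.
  obtain ⟨w₀, hw₀, hmin⟩ := Set.exists_min_image _ (fun w => (m - l w) / (β - f w))
    (hP.finite_vertices.subset sdiff_subset) hW
  set t := (m - l w₀) / (β - f w₀) with ht
  have hv : ∀ w ∈ vertices P, (l - t • f) w ≤ m - t * β := by
    intro w hw
    have e : (l - t • f) w = l w - t * f w := by simp
    rw [e]
    by_cases hwB : w ∈ B
    · rw [hBe] at hwB
      have := hl w hwB.1
      rw [hwB.2]; linarith
    · have h1 := hmin w ⟨hw, hwB⟩
      have h2 := hlt w ⟨hw, hwB⟩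
      rw [le_div_iff₀ h2] at h1
      linarith
  refine ⟨_, isFace_setOf fun y hy => hP.le_of_forall_vertices hv hy, ?_, fun h => ?_⟩
  · ext x
    constructor
    · rintro ⟨⟨hx, h1⟩, h2⟩
      rw [hBe] at h2
      rw [hee]
      simp only [sub_apply, smul_apply, smul_eq_mul,
        h2.2] at h1
      exact ⟨hx, by linarith⟩
    · intro hx
      have hxB := heB hx
      refine ⟨?_, hxB⟩
      rw [hee] at hx
      rw [hBe] at hxB
      exact ⟨hx.1, by simp [hx.2, hxB.2]⟩
  · refine hw₀.2 (h ⟨vertices_subset hw₀.1, ?_⟩)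
    have := hlt w₀ hw₀
    have e : t * (β - f w₀) = m - l w₀ := div_mul_cancel₀ _ this.ne'
    simp only [sub_apply, smul_apply, smul_eq_mul]
    linarith

/-! ### The edge graph on the ambient space -/

/-- The graph of `P`, as a graph on the ambient space. -/
def edgeGraph (P : Set E) : SimpleGraph E where
  Adj x y := x ≠ y ∧ IsFace P (segment ℝ x y)
  symm := ⟨fun x y h => ⟨h.1.symm, by rw [segment_symm]; exact h.2⟩⟩
  loopless := ⟨fun _ h => h.1 rfl⟩

theorem isFace_segment_left {x y : E} (h : x ≠ y) : IsFace (segment ℝ x y) {x} := by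
  have hS : IsPolytope (segment ℝ x y) := ⟨{x, y}, by simp, (convexHull_pair x y).symm⟩
  have : x ∈ vertices (segment ℝ x y) := by
    rw [hS.vertices_eq, mem_extremePoints_iff_left]
    refine ⟨left_mem_segment ℝ x y, ?_⟩
    rintro p hp q hq hpq
    rw [segment_eq_image_lineMap] at hp hq
    obtain ⟨s, hs, rfl⟩ := hp
    obtain ⟨r, hr, rfl⟩ := hq
    obtain ⟨a, b, ha, hb, hab, he⟩ := hpq
    have hyx : y - x ≠ 0 := sub_ne_zero.2 h.symm
    have e : (a * s + b * r) • (y - x) = 0 := by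
      simp only [AffineMap.lineMap_apply_module'] at he
      have hb' : b = 1 - a := by linarith
      subst hb'
      have : a • (s • (y - x) + x) + (1 - a) • (r • (y - x) + x)
          = (a * s + (1 - a) * r) • (y - x) + x := by module
      rw [this] at he
      simpa using he
    have e2 := (smul_eq_zero.1 e).resolve_right hyx
    have h1 := mul_nonneg ha.le hs.1
    have h2 := mul_nonneg hb.le hr.1
    have : s = 0 := by
      have : a * s = 0 := by linarith
      exact (mul_eq_zero.1 this).resolve_left ha.ne'
    simp [this]
  exact this

theorem IsPolytope.mem_vertices_of_adj (hP : IsPolytope P) {x y : E}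
    (h : (edgeGraph P).Adj x y) : x ∈ vertices P :=
  hP.isFace_trans h.2 (isFace_segment_left h.1)

theorem IsPolytope.edgeGraph_adj_face (hP : IsPolytope P) (hF : IsFace P F) {x y : E} :
    (edgeGraph F).Adj x y ↔ (edgeGraph P).Adj x y ∧ x ∈ F ∧ y ∈ F := by
  constructor
  · rintro ⟨hne, h⟩
    exact ⟨⟨hne, hP.isFace_trans hF h⟩, h.subset (left_mem_segment ℝ x y),
      h.subset (right_mem_segment ℝ x y)⟩
  · rintro ⟨⟨hne, h⟩, hx, hy⟩
    exact ⟨hne, h.mono hF ((IsExposed.convex hF hP.convex).segment_subset hx hy)⟩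

theorem IsPolytope.eq_or_eq_of_mem_segment (hP : IsPolytope P) {x y z : E} (hz : z ∈ vertices P)
    (hx : x ∈ P) (hy : y ∈ P) (h : z ∈ segment ℝ x y) : z = x ∨ z = y := by
  rw [hP.vertices_eq, mem_extremePoints_iff_forall_segment] at hz
  rcases hz.2 x hx y hy h with h | h
  · exact Or.inl h.symm
  · exact Or.inr h.symm

end Basics

section VertexFigure

variable {E : Type*} [NormedAddCommGroup E] [InnerProductSpace ℝ E] {P F G : Set E}
  {l : E →L[ℝ] ℝ} {u : E}

/-! ### Vertex figures -/

/-- The hyperplane `{x | l x = l u - 1}` strictly separates the vertex `u` of the polytope `P` from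
the other vertices. -/
structure IsCut (P : Set E) (l : E →L[ℝ] ℝ) (u : E) : Prop where
  isPolytope : IsPolytope P
  mem_vertices : u ∈ vertices P
  apply_lt : ∀ x ∈ P, x ≠ u → l x < l u
  one_lt : ∀ w ∈ vertices P, w ≠ u → 1 < l u - l w

/-- The central projection from `u` to the hyperplane `{x | l x = l u - 1}`. -/
def proj (l : E →L[ℝ] ℝ) (u x : E) : E := u + (l u - l x)⁻¹ • (x - u)

/-- The vertex figure of `P` at `u`, in the hyperplane `{x | l x = l u - 1}`. -/
def vertexFigure (P : Set E) (l : E →L[ℝ] ℝ) (u : E) : Set E :=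
  convexHull ℝ (proj l u '' (vertices P \ {u}))

theorem IsPolytope.exists_isCut (hP : IsPolytope P) (hu : u ∈ vertices P) :
    ∃ l, IsCut P l u := by
  obtain ⟨l, hl⟩ := hP.exists_lt_of_mem_vertices hu
  obtain ⟨t, ht, htw⟩ := exists_pos_forall_lt_mul hP.finite_vertices (fun w => l u - l w)
    (fun _ => 1)
  refine ⟨t • l, hP, hu, fun x hx hxu => ?_, fun w hw hwu => ?_⟩
  · simpa using mul_lt_mul_of_pos_left (hl x hx hxu) ht
  · have := htw w hw (sub_pos.2 (hl w (vertices_subset hw) hwu))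
    simpa [mul_sub] using this

theorem apply_proj (h : E →L[ℝ] ℝ) (x : E) :
    h (proj l u x) = h u + (l u - l x)⁻¹ * (h x - h u) := by
  simp [proj]

theorem isPolytope_vertexFigure (hP : IsPolytope P) : IsPolytope (vertexFigure P l u) :=
  ⟨_, (hP.finite_vertices.subset sdiff_subset).image _, rfl⟩

namespace IsCut

variable (hc : IsCut P l u)
include hc

theorem pos {x : E} (hx : x ∈ P) (hxu : x ≠ u) : 0 < l u - l x :=
  sub_pos.2 (hc.apply_lt x hx hxu)

theorem apply_proj_self {x : E} (hx : x ∈ P) (hxu : x ≠ u) : l (proj l u x) = l u - 1 := by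
  have := hc.pos hx hxu
  rw [apply_proj]
  field_simp
  ring

theorem proj_mem_segment {w : E} (hw : w ∈ vertices P) (hwu : w ≠ u) :
    proj l u w ∈ segment ℝ u w := by
  have h1 := hc.one_lt w hw hwu
  rw [segment_eq_image']
  exact ⟨(l u - l w)⁻¹, ⟨by positivity, inv_le_one_of_one_le₀ h1.le⟩, rfl⟩

theorem vertexFigure_subset : vertexFigure P l u ⊆ P := by
  refine convexHull_min ?_ hc.isPolytope.convex
  rintro _ ⟨w, ⟨hw, hwu⟩, rfl⟩
  exact hc.isPolytope.convex.segment_subset (vertices_subset hc.mem_vertices)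
    (vertices_subset hw) (hc.proj_mem_segment hw hwu)

theorem apply_of_mem {q : E} (hq : q ∈ vertexFigure P l u) : l q = l u - 1 := by
  refine convexHull_min (t := {y | l y = l u - 1}) ?_
    (convex_hyperplane l.toLinearMap.isLinear _) hq
  rintro _ ⟨w, ⟨hw, hwu⟩, rfl⟩
  exact hc.apply_proj_self (vertices_subset hw) hwu

theorem ne_of_mem {q : E} (hq : q ∈ vertexFigure P l u) : q ≠ u := by
  rintro rfl
  have := hc.apply_of_mem hq
  linarith

/-- The points strictly below `u` that project into the vertex figure form a convex set, which thus
contains the hull of the other vertices. Any point of `P` except `u` lies on a ray from `u` through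
a point of that hull. -/
theorem proj_mem {x : E} (hx : x ∈ P) (hxu : x ≠ u) : proj l u x ∈ vertexFigure P l u := by
  have hW : convexHull ℝ (vertices P \ {u}) ⊆
      {y | l y < l u ∧ proj l u y ∈ vertexFigure P l u} := by
    refine convexHull_min ?_ ?_
    · rintro w ⟨hw, hwu⟩
      exact ⟨hc.apply_lt w (vertices_subset hw) hwu, subset_convexHull ℝ _ ⟨w, ⟨hw, hwu⟩, rfl⟩⟩
    · rintro y ⟨hy, hy'⟩ z ⟨hz, hz'⟩ a b ha hb hab
      have e : l (a • y + b • z) = a * l y + b * l z := by simp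
      have hy0 : 0 < l u - l y := sub_pos.2 hy
      have hz0 : 0 < l u - l z := sub_pos.2 hz
      have e1 : l u - l (a • y + b • z) = a * (l u - l y) + b * (l u - l z) := by
        rw [e]
        linear_combination (-l u) * hab
      have hlt : 0 < l u - l (a • y + b • z) := by
        rw [e1]
        rcases ha.eq_or_lt with rfl | ha'
        · have : b = 1 := by linarith
          subst this
          linarith
        · have := mul_pos ha' hy0
          have := mul_nonneg hb hz0.le
          linarith
      refine ⟨sub_pos.1 hlt, ?_⟩
      set D := l u - l (a • y + b • z) with hD
      have := convex_convexHull ℝ (proj l u '' (vertices P \ {u})) hy' hz'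
        (a := a * (l u - l y) / D) (b := b * (l u - l z) / D) (by positivity) (by positivity)
        (by rw [← add_div, ← e1, div_self hlt.ne'])
      change _ ∈ vertexFigure P l u at this
      convert this using 1
      simp only [proj, ← hD]
      have h1 : a * (l u - l y) / D * (l u - l y)⁻¹ = a / D := by field_simp
      have h2 : b * (l u - l z) / D * (l u - l z)⁻¹ = b / D := by field_simp
      have h3 : a * (l u - l y) / D + b * (l u - l z) / D = 1 := by
        rw [← add_div, ← e1, div_self hlt.ne']
      have h4 : D⁻¹ * (a + b) = a / D + b / D := by field_simp
      have h5 : D⁻¹ * a = a / D := by field_simp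
      have h6 : D⁻¹ * b = b / D := by field_simp
      calc u + D⁻¹ • (a • y + b • z - u)
          = u + ((D⁻¹ * a) • (y - u) + (D⁻¹ * b) • (z - u)) := by
            have : b = 1 - a := by linarith
            subst this
            module
        _ = (a * (l u - l y) / D + b * (l u - l z) / D) • u + ((a / D) • (y - u) +
              (b / D) • (z - u)) := by rw [h3, h5, h6, one_smul]
        _ = _ := by
            rw [← h1, ← h2]
            module
  have hx' := hx
  rw [← hc.isPolytope.convexHull_vertices, ← insert_sdiff_self_of_mem hc.mem_vertices] at hx'
  rcases (vertices P \ {u}).eq_empty_or_nonempty with h0 | hne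
  · rw [h0, insert_empty_eq, convexHull_singleton] at hx'
    exact absurd hx' hxu
  rw [convexHull_insert hne, mem_convexJoin] at hx'
  obtain ⟨u', hu', y, hy, a, b, ha, hb, hab, hxe⟩ := hx'
  rw [mem_singleton_iff] at hu'
  rw [hu'] at hxe
  obtain ⟨hyl, hy'⟩ := hW hy
  have hb0 : b ≠ 0 := by
    rintro rfl
    rw [add_zero] at hab
    exact hxu (by simp [← hxe, hab])
  have hyl' : l u - l y ≠ 0 := (sub_pos.2 hyl).ne'
  have e : proj l u x = proj l u y := by
    have ha' : a = 1 - b := by linarith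
    subst ha'
    have e1 : l u - l x = b * (l u - l y) := by
      rw [← hxe]
      simp
      ring
    have e2 : x - u = b • (y - u) := by
      rw [← hxe]
      module
    simp only [proj, e1, e2, smul_smul]
    congr 2
    field_simp
  rw [e]
  exact hy'

theorem proj_mem_face (hF : IsFace P F) (huF : u ∈ F) {x : E} (hx : x ∈ F) (hxu : x ≠ u) :
    proj l u x ∈ F := by
  obtain ⟨h, n, -, rfl⟩ := hF.exists_eq_setOf ⟨u, huF⟩
  exact ⟨hc.vertexFigure_subset (hc.proj_mem hx.1 hxu), by rw [apply_proj, huF.2, hx.2]; ring⟩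

theorem mem_face_of_proj (hF : IsFace P F) (huF : u ∈ F) {x : E} (hx : x ∈ P) (hxu : x ≠ u)
    (h : proj l u x ∈ F) : x ∈ F := by
  obtain ⟨h, n, -, rfl⟩ := hF.exists_eq_setOf ⟨u, huF⟩
  refine ⟨hx, ?_⟩
  have h2 := h.2
  rw [apply_proj, huF.2] at h2
  have := (mul_eq_zero.1 (add_eq_left.1 h2)).resolve_left (inv_ne_zero (hc.pos hx hxu).ne')
  linarith

theorem isFace_inter (hF : IsFace P F) : IsFace (vertexFigure P l u) (F ∩ vertexFigure P l u) := by
  rintro hne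
  obtain ⟨h, n, hle, rfl⟩ := hF.exists_eq_setOf (hne.mono inter_subset_left)
  have := isFace_setOf (P := vertexFigure P l u) (l := h) (m := n)
    fun y hy => hle y (hc.vertexFigure_subset hy)
  have e : {x ∈ vertexFigure P l u | h x = n} = {x ∈ P | h x = n} ∩ vertexFigure P l u :=
    Set.ext fun x => ⟨fun hx => ⟨⟨hc.vertexFigure_subset hx.1, hx.2⟩, hx.1⟩,
      fun hx => ⟨hx.2, hx.1.2⟩⟩
  rw [e] at this
  exact this hne

theorem exists_isFace (hG : IsFace (vertexFigure P l u) G) (hne : G.Nonempty) :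
    ∃ F, IsFace P F ∧ u ∈ F ∧ F ∩ vertexFigure P l u = G := by
  obtain ⟨k, n, hk, rfl⟩ := hG.exists_eq_setOf hne
  -- The multiple of `l` is chosen so that `h` takes the value `h u` on `G`, which makes `u` a point
  -- of the supported face.
  set h : E →L[ℝ] ℝ := k + (n - k u) • l with hh
  have he : ∀ x, h x = k x + (n - k u) * l x := fun x => by simp [hh]
  have hle : ∀ x ∈ P, h x ≤ h u := by
    intro x hx
    rcases eq_or_ne x u with rfl | hxu
    · exact le_rfl
    have hq := hc.proj_mem hx hxu
    have h1 := hk _ hq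
    have h2 := hc.pos hx hxu
    have h3 : h (proj l u x) ≤ h u := by
      rw [he, he, hc.apply_of_mem hq]
      linarith
    rw [apply_proj] at h3
    by_contra hlt
    have := mul_pos (inv_pos.2 h2) (sub_pos.2 (not_le.1 hlt))
    linarith
  refine ⟨_, isFace_setOf hle, ⟨vertices_subset hc.mem_vertices, rfl⟩, ?_⟩
  ext x
  constructor
  · rintro ⟨⟨hx, hxu⟩, hxQ⟩
    rw [he, he, hc.apply_of_mem hxQ] at hxu
    exact ⟨hxQ, by linarith⟩
  · rintro ⟨hxQ, hxn⟩
    refine ⟨⟨hc.vertexFigure_subset hxQ, ?_⟩, hxQ⟩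
    rw [he, he, hc.apply_of_mem hxQ, hxn]
    ring

theorem proj_injOn : InjOn (proj l u) (vertices P \ {u}) := by
  have key : ∀ w ∈ vertices P \ {u}, ∀ z ∈ vertices P \ {u}, proj l u w = proj l u z →
      l u - l w ≤ l u - l z → w = z := by
    rintro w ⟨hw, hwu⟩ z ⟨hz, hzu⟩ he hle
    have hw0 := hc.pos (vertices_subset hw) hwu
    have hz0 := hc.pos (vertices_subset hz) hzu
    have e : (l u - l w)⁻¹ • (w - u) = (l u - l z)⁻¹ • (z - u) := by simpa [proj] using he
    have : w ∈ segment ℝ u z := by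
      rw [segment_eq_image']
      refine ⟨(l u - l w) * (l u - l z)⁻¹, ⟨by positivity, ?_⟩, ?_⟩
      · rw [← div_eq_mul_inv]
        exact (div_le_one hz0).2 hle
      · simp only
        rw [mul_smul, ← e, smul_smul, mul_inv_cancel₀ hw0.ne', one_smul, add_sub_cancel]
    exact (hc.isPolytope.eq_or_eq_of_mem_segment hw (vertices_subset hc.mem_vertices)
      (vertices_subset hz) this).resolve_left hwu
  intro w hw z hz he
  rcases le_total (l u - l w) (l u - l z) with h | h
  · exact key w hw z hz he h
  · exact (key z hz w hw he.symm h).symm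

theorem mem_of_adj {w : E} (h : (edgeGraph P).Adj u w) : w ∈ vertices P \ {u} :=
  ⟨hc.isPolytope.mem_vertices_of_adj h.symm, h.ne'⟩

theorem proj_mem_vertices {w : E} (h : (edgeGraph P).Adj u w) :
    proj l u w ∈ vertices (vertexFigure P l u) := by
  have hw := hc.mem_of_adj h
  have hwP := vertices_subset hw.1
  have : segment ℝ u w ∩ vertexFigure P l u = {proj l u w} := by
    ext q
    constructor
    · rintro ⟨hq, hqQ⟩
      have hlq := hc.apply_of_mem hqQ
      rw [segment_eq_image'] at hq
      obtain ⟨s, -, rfl⟩ := hq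
      have h0 := hc.pos hwP hw.2
      have hs : s = (l u - l w)⁻¹ := by
        simp only [map_add, map_smul, map_sub, smul_eq_mul] at hlq
        field_simp
        linarith
      rw [hs]
      rfl
    · rintro rfl
      exact ⟨hc.proj_mem_segment hw.1 hw.2, hc.proj_mem hwP hw.2⟩
  have h2 := hc.isFace_inter h.2
  rwa [this] at h2

/-- The face of `P` through `u` that cuts out `q` projects to the single point `q`, so by
injectivity it has just one vertex besides `u` and is an edge. -/
theorem exists_proj_eq {q : E} (hq : q ∈ vertices (vertexFigure P l u)) :
    ∃ w, (edgeGraph P).Adj u w ∧ proj l u w = q := by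
  obtain ⟨F, hF, huF, hFq⟩ := hc.exists_isFace hq (singleton_nonempty q)
  have hqQ := vertices_subset hq
  have hqF : q ∈ F := by
    have : q ∈ F ∩ vertexFigure P l u := by rw [hFq]; rfl
    exact this.1
  have hproj : ∀ x ∈ F, x ≠ u → proj l u x = q := by
    intro x hx hxu
    have : proj l u x ∈ F ∩ vertexFigure P l u :=
      ⟨hc.proj_mem_face hF huF hx hxu, hc.proj_mem (hF.subset hx) hxu⟩
    rw [hFq] at this
    exact this
  have hFP := hc.isPolytope.isPolytope_of_isFace hF
  have hFv := hc.isPolytope.vertices_of_isFace hF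
  obtain ⟨w, hw, hwu⟩ : ∃ w ∈ vertices F, w ≠ u := by
    by_contra! hcon
    have : F ⊆ {u} := by
      rw [← hFP.convexHull_vertices, ← convexHull_singleton (𝕜 := ℝ) u]
      exact convexHull_mono hcon
    exact hc.ne_of_mem hqQ (this hqF)
  rw [hFv] at hw
  have hFe : F = segment ℝ u w := by
    rw [← hFP.convexHull_vertices, ← convexHull_pair]
    congr 1
    ext z
    rw [hFv]
    constructor
    · rintro ⟨hzF, hz⟩
      by_cases hzu : z = u
      · exact Or.inl hzu
      · exact Or.inr (hc.proj_injOn ⟨hz, hzu⟩ ⟨hw.2, hwu⟩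
          ((hproj z hzF hzu).trans (hproj w hw.1 hwu).symm))
    · rintro (rfl | rfl)
      · exact ⟨huF, hc.mem_vertices⟩
      · exact hw
  exact ⟨w, ⟨hwu.symm, hFe ▸ hF⟩, hproj w hw.1 hwu⟩

/-- An edge of the vertex figure comes from a face that contains exactly two neighbours of `u`. -/
theorem exists_isFace_of_adj {w z : E} (hw : (edgeGraph P).Adj u w) (hz : (edgeGraph P).Adj u z)
    (h : (edgeGraph (vertexFigure P l u)).Adj (proj l u w) (proj l u z)) :
    ∃ F, IsFace P F ∧ u ∈ F ∧ w ∈ F ∧ z ∈ F ∧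
      F ∩ vertexFigure P l u = segment ℝ (proj l u w) (proj l u z) ∧
      ∀ y ∈ F, (edgeGraph P).Adj u y → y = w ∨ y = z := by
  obtain ⟨F, hF, huF, hFe⟩ := hc.exists_isFace h.2 ⟨_, left_mem_segment ℝ _ _⟩
  have hw' := hc.mem_of_adj hw
  have hz' := hc.mem_of_adj hz
  have h1 : proj l u w ∈ F ∩ vertexFigure P l u := hFe ▸ left_mem_segment ℝ _ _
  have h2 : proj l u z ∈ F ∩ vertexFigure P l u := hFe ▸ right_mem_segment ℝ _ _
  refine ⟨F, hF, huF, hc.mem_face_of_proj hF huF (vertices_subset hw'.1) hw'.2 h1.1,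
    hc.mem_face_of_proj hF huF (vertices_subset hz'.1) hz'.2 h2.1, hFe, fun y hyF hy => ?_⟩
  have hy' := hc.mem_of_adj hy
  have h3 : proj l u y ∈ F ∩ vertexFigure P l u :=
    ⟨hc.proj_mem_face hF huF hyF hy'.2, hc.proj_mem (hF.subset hyF) hy'.2⟩
  rw [hFe] at h3
  rcases (isPolytope_vertexFigure hc.isPolytope).eq_or_eq_of_mem_segment
    (hc.proj_mem_vertices hy) h1.2 h2.2 h3 with h4 | h4
  · exact Or.inl (hc.proj_injOn hy' hw' h4)
  · exact Or.inr (hc.proj_injOn hy' hz' h4)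

end IsCut

/-! ### Monotone paths and connectivity -/

/-- If no neighbour improved on `u`, then `h ≤ h u` would hold at the vertices of the vertex figure,
hence on all of it, hence on `P`. -/
theorem IsPolytope.exists_adj_lt (hP : IsPolytope P) (hu : u ∈ vertices P) (h : E →L[ℝ] ℝ)
    {x : E} (hx : x ∈ P) (hlt : h u < h x) : ∃ w, (edgeGraph P).Adj u w ∧ h u < h w := by
  by_contra! hcon
  obtain ⟨l, hc⟩ := hP.exists_isCut hu
  have hxu : x ≠ u := by rintro rfl; exact lt_irrefl _ hlt
  have h1 : h (proj l u x) ≤ h u := by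
    refine (isPolytope_vertexFigure hP).le_of_forall_vertices (fun q hq => ?_)
      (hc.proj_mem hx hxu)
    obtain ⟨w, hw, rfl⟩ := hc.exists_proj_eq hq
    have hw' := hc.mem_of_adj hw
    have := inv_pos.2 (hc.pos (vertices_subset hw'.1) hw'.2)
    rw [apply_proj]
    nlinarith [hcon w hw]
  rw [apply_proj] at h1
  have := mul_pos (inv_pos.2 (hc.pos hx hxu)) (sub_pos.2 hlt)
  linarith

/-- The simplex walk. The graph `H` records which edges it may use, so that one statement serves
every restriction on the path. -/
theorem IsPolytope.exists_reachable_max (hP : IsPolytope P) (h : E →L[ℝ] ℝ) {x : E}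
    (hx : x ∈ vertices P) {H : SimpleGraph E}
    (hH : ∀ a b, (edgeGraph P).Adj a b → (a = x ∨ h x < h a) → h a < h b → H.Adj a b) :
    ∃ y ∈ vertices P, (∀ z ∈ P, h z ≤ h y) ∧ h x ≤ h y ∧ H.Reachable x y := by
  induction hn : {z ∈ vertices P | h x < h z}.ncard using Nat.strong_induction_on
    generalizing x with
  | _ n ih =>
    by_cases hmax : ∀ z ∈ P, h z ≤ h x
    · exact ⟨x, hx, hmax, le_rfl, .refl _⟩
    push Not at hmax
    obtain ⟨z, hz, hlt⟩ := hmax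
    obtain ⟨w, hw, hxw⟩ := hP.exists_adj_lt hx h hz hlt
    have hwv := hP.mem_vertices_of_adj hw.symm
    obtain ⟨y, hy, hym, hle, hr⟩ := ih _ (by
      rw [← hn]
      refine Set.ncard_lt_ncard ⟨fun a ha => ⟨ha.1, hxw.trans ha.2⟩, fun hsub => ?_⟩
        (hP.finite_vertices.subset fun a ha => ha.1)
      exact lt_irrefl _ (hsub (a := w) ⟨hwv, hxw⟩).2) hwv (fun a b hab ha hlt => hH a b hab
        (Or.inr (ha.elim (fun e => e ▸ hxw) fun h' => hxw.trans h')) hlt) rfl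
    exact ⟨y, hy, hym, hxw.le.trans hle, (hH x w hw (Or.inl rfl) hxw).reachable.trans hr⟩

theorem IsPolytope.reachable (hP : IsPolytope P) {x y : E} (hx : x ∈ vertices P)
    (hy : y ∈ vertices P) : (edgeGraph P).Reachable x y := by
  obtain ⟨l, hl⟩ := hP.exists_lt_of_mem_vertices hy
  obtain ⟨z, hz, hmax, -, hr⟩ := hP.exists_reachable_max l hx (H := edgeGraph P)
    fun a b hab _ _ => hab
  have : z = y := by
    by_contra hne
    exact absurd (hmax y (vertices_subset hy)) (not_le.2 (hl z (vertices_subset hz) hne))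
  exact this ▸ hr

/-- Two vertices on a closed halfspace are joined by a path whose other vertices lie in its
interior. -/
theorem IsPolytope.reachable_of_le (hP : IsPolytope P) (h : E →L[ℝ] ℝ) {c : ℝ} {x y : E}
    (hx : x ∈ vertices P) (hy : y ∈ vertices P) (hcx : c ≤ h x) (hcy : c ≤ h y)
    (hex : ∃ z ∈ P, c < h z) {H : SimpleGraph E}
    (hH : ∀ a b, (edgeGraph P).Adj a b → (a = x ∨ a = y ∨ c < h a) → c < h b → H.Adj a b) :
    H.Reachable x y := by
  obtain ⟨z, hz, hcz⟩ := hex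
  obtain ⟨x', hx', hxm, hxx, hxr⟩ := hP.exists_reachable_max h hx (H := H) fun a b hab ha hlt => by
    rcases ha with rfl | ha
    · exact hH a b hab (Or.inl rfl) (hcx.trans_lt hlt)
    · exact hH a b hab (Or.inr (Or.inr (hcx.trans_lt ha))) (hcx.trans_lt (ha.trans hlt))
  obtain ⟨y', hy', hym, hyy, hyr⟩ := hP.exists_reachable_max h hy (H := H) fun a b hab ha hlt => by
    rcases ha with rfl | ha
    · exact hH a b hab (Or.inr (Or.inl rfl)) (hcy.trans_lt hlt)
    · exact hH a b hab (Or.inr (Or.inr (hcy.trans_lt ha))) (hcy.trans_lt (ha.trans hlt))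
  have hF := isFace_setOf (P := P) hxm
  have hyx : h y' = h x' :=
    le_antisymm (hxm _ (vertices_subset hy')) (hym _ (vertices_subset hx'))
  have hlt : c < h x' := hcz.trans_le (hxm z hz)
  have hr := (hP.isPolytope_of_isFace hF).reachable (x := x') (y := y')
    (by rw [hP.vertices_of_isFace hF]; exact ⟨⟨vertices_subset hx', rfl⟩, hx'⟩)
    (by rw [hP.vertices_of_isFace hF]; exact ⟨⟨vertices_subset hy', hyx⟩, hy'⟩)
  refine hxr.trans (.trans (hr.mono fun a b hab => ?_) hyr.symm)
  obtain ⟨hab, ha, hb⟩ := (hP.edgeGraph_adj_face hF).1 hab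
  exact hH a b hab (Or.inr (Or.inr (ha.2 ▸ hlt))) (hb.2 ▸ hlt)

/-- The graph `G` with all edges removed that leave the set `T` or lie outside it. -/
def restrict {V : Type*} (G : SimpleGraph V) (T : Set V) : SimpleGraph V where
  Adj a b := G.Adj a b ∧ a ∈ T ∧ b ∈ T
  symm := ⟨fun _ _ h => ⟨h.1.symm, h.2.2, h.2.1⟩⟩
  loopless := ⟨fun _ h => h.1.ne rfl⟩

theorem restrict_mono {V : Type*} {G G' : SimpleGraph V} {S T : Set V} (hG : G ≤ G')
    (hST : S ⊆ T) : restrict G S ≤ restrict G' T :=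
  fun _ _ h => ⟨hG h.1, hST h.2.1, hST h.2.2⟩

/-- Deleting vertices that lie, together with a further vertex, on a hyperplane does not disconnect
the graph of a polytope that does not lie on that hyperplane. -/
theorem IsPolytope.reachable_of_hyperplane (hP : IsPolytope P) (h : E →L[ℝ] ℝ) {K : Set E}
    {x y : E} (hx : x ∈ vertices P) (hy : y ∈ vertices P) (hxK : x ∉ K) (hyK : y ∉ K)
    (hK : ∀ k ∈ K, h k = h x) (hex : ∃ z ∈ P, h z ≠ h x) :
    (restrict (edgeGraph P) Kᶜ).Reachable x y := by
  -- The path meets the hyperplane at most in `x` and `y`. It remains to choose the sign of `h` so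
  -- that `y` is not below `x` and some point of `P` is above.
  have key : ∀ g : E →L[ℝ] ℝ, (∀ k ∈ K, g k = g x) → (∃ z ∈ P, g x < g z) → g x ≤ g y →
      (restrict (edgeGraph P) Kᶜ).Reachable x y := by
    intro g hg hz hxy
    refine hP.reachable_of_le g hx hy le_rfl hxy hz fun a b hab ha hb => ⟨hab, ?_, fun hbK => ?_⟩
    · rcases ha with rfl | rfl | ha
      · exact hxK
      · exact hyK
      · exact fun haK => ha.ne' (hg a haK)
    · exact hb.ne' (hg b hbK)
  obtain ⟨z, hz, hzx⟩ := hex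
  have hneg : ∀ k ∈ K, (-h) k = (-h) x := fun k hk => by simp [hK k hk]
  rcases lt_trichotomy (h y) (h x) with hlt | heq | hlt
  · exact key (-h) hneg ⟨y, vertices_subset hy, by simpa using hlt⟩ (by simpa using hlt.le)
  · rcases hzx.lt_or_gt with hz' | hz'
    · exact key (-h) hneg ⟨z, hz, by simpa using hz'⟩ (by simp [heq])
    · exact key h hK ⟨z, hz, hz'⟩ heq.ge
  · exact key h hK ⟨y, vertices_subset hy, hlt⟩ hlt.le

/-- Fewer points than the dimension of `P` lie, together with a given point of `P`, on a hyperplane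
not containing `P`. -/
theorem exists_hyperplane [FiniteDimensional ℝ E] {K : Set E} {x : E} (hx : x ∈ P)
    (hK : K.encard < Module.finrank ℝ (vectorSpan ℝ P)) :
    ∃ h : E →L[ℝ] ℝ, (∀ k ∈ K, h k = h x) ∧ ∃ z ∈ P, h z ≠ h x := by
  have hfin : K.Finite := Set.finite_of_encard_le_coe hK.le
  set S : Submodule ℝ E := Submodule.span ℝ ((fun k => k - x) '' K) with hS
  have hSr : Module.finrank ℝ S < Module.finrank ℝ (vectorSpan ℝ P) := by
    have hfi : ((fun k => k - x) '' K).Finite := hfin.image _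
    have := hfi.fintype
    have h1 := finrank_span_le_card (R := ℝ) ((fun k => k - x) '' K)
    have h2 : (((fun k => k - x) '' K).toFinset.card : ℕ∞) ≤ K.encard := by
      rw [← Set.encard_coe_eq_coe_finsetCard, Set.coe_toFinset]
      exact Set.encard_image_le _ _
    have h3 := h2.trans_lt hK
    exact h1.trans_lt (by exact_mod_cast h3)
  have hz : ∃ z ∈ P, z - x ∉ S := by
    by_contra! hcon
    have : vectorSpan ℝ P ≤ S := by
      rw [vectorSpan_eq_span_vsub_set_right ℝ hx, Submodule.span_le]
      rintro _ ⟨z, hz, rfl⟩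
      exact hcon z hz
    exact absurd (Submodule.finrank_mono this) (not_le.2 hSr)
  obtain ⟨z, hz, hzS⟩ := hz
  obtain ⟨g, hg, hgS⟩ := Submodule.exists_dual_map_eq_bot_of_notMem hzS inferInstance
  refine ⟨LinearMap.toContinuousLinearMap g, fun k hk => ?_, z, hz, fun he => hg ?_⟩
  · have : g (k - x) ∈ S.map g := ⟨_, Submodule.subset_span ⟨k, hk, rfl⟩, rfl⟩
    rw [hgS, Submodule.mem_bot, map_sub, sub_eq_zero] at this
    exact this
  · rw [map_sub, sub_eq_zero]
    exact he

/-- **Balinski's theorem**. -/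
theorem IsPolytope.reachable_compl [FiniteDimensional ℝ E] (hP : IsPolytope P) {K : Set E}
    (hK : K.encard < Module.finrank ℝ (vectorSpan ℝ P)) {x y : E} (hx : x ∈ vertices P)
    (hy : y ∈ vertices P) (hxK : x ∉ K) (hyK : y ∉ K) :
    (restrict (edgeGraph P) Kᶜ).Reachable x y := by
  obtain ⟨h, hKh, hex⟩ := exists_hyperplane (vertices_subset hx) hK
  exact hP.reachable_of_hyperplane h hx hy hxK hyK hKh hex

/-! ### Links of vertices -/

/-- The graph of the vertex figure of `P` at `u`, carried over to the neighbours of `u`. -/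
def link (P : Set E) (u : E) : SimpleGraph E where
  Adj w z := w ≠ z ∧ (edgeGraph P).Adj u w ∧ (edgeGraph P).Adj u z ∧ ∃ F, IsFace P F ∧ u ∈ F ∧
    w ∈ F ∧ z ∈ F ∧ ∀ y ∈ F, (edgeGraph P).Adj u y → y = w ∨ y = z
  symm := ⟨fun _ _ ⟨h, hw, hz, F, hF, huF, hwF, hzF, H⟩ =>
    ⟨h.symm, hz, hw, F, hF, huF, hzF, hwF, fun y hy hy' => (H y hy hy').symm⟩⟩
  loopless := ⟨fun _ h => h.1 rfl⟩

/-- With fewer neighbours, some hyperplane through `u` and all of them would miss a point of `P`,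
and a monotone step towards it would leave the hyperplane. -/
theorem IsPolytope.encard_neighborSet [FiniteDimensional ℝ E] (hP : IsPolytope P)
    (hu : u ∈ vertices P) :
    Module.finrank ℝ (vectorSpan ℝ P) ≤ ((edgeGraph P).neighborSet u).encard := by
  by_contra! hcon
  obtain ⟨h, hK, z, hz, hne⟩ := exists_hyperplane (vertices_subset hu) hcon
  rcases hne.lt_or_gt with hlt | hlt
  · obtain ⟨w, hw, hlt⟩ := hP.exists_adj_lt hu (-h) hz (by simpa using hlt)
    simp [hK w hw] at hlt
  · obtain ⟨w, hw, hlt⟩ := hP.exists_adj_lt hu h hz hlt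
    simp [hK w hw] at hlt

/-- Balinski's theorem for the vertex figure. -/
theorem IsPolytope.link_reachable_compl [FiniteDimensional ℝ E] (hP : IsPolytope P) {K : Set E}
    (hK : K.encard + 1 < Module.finrank ℝ (vectorSpan ℝ P)) {w z : E}
    (hKu : K ⊆ (edgeGraph P).neighborSet u)
    (hw : (edgeGraph P).Adj u w) (hz : (edgeGraph P).Adj u z) (hwK : w ∉ K) (hzK : z ∉ K) :
    (restrict (link P u) Kᶜ).Reachable w z := by
  have hu := hP.mem_vertices_of_adj hw
  obtain ⟨l, hc⟩ := hP.exists_isCut hu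
  -- The hyperplane passes through `u`, so projection from `u` preserves it. Including `w` accounts
  -- for the extra one in `hK`.
  obtain ⟨h, hKh, x, hx, hxu⟩ := exists_hyperplane (K := insert w K) (vertices_subset hu)
    ((Set.encard_insert_le _ _).trans_lt hK)
  have hproj : ∀ k ∈ insert w K, h (proj l u k) = h u := fun k hk => by
    rw [apply_proj, hKh k hk]; ring
  have hx' : x ≠ u := by rintro rfl; exact hxu rfl
  have hN : ∀ k ∈ insert w K, (edgeGraph P).Adj u k := fun k hk =>
    hk.elim (fun e => e ▸ hw) fun h => hKu h
  have hnot : ∀ y, (edgeGraph P).Adj u y → y ∉ K → proj l u y ∉ proj l u '' K := by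
    rintro y hy hyK ⟨k, hk, he⟩
    exact hyK (hc.proj_injOn (hc.mem_of_adj (hKu hk)) (hc.mem_of_adj hy) he ▸ hk)
  have hr := (isPolytope_vertexFigure (l := l) (u := u) hP).reachable_of_hyperplane h
    (K := proj l u '' K) (hc.proj_mem_vertices hw) (hc.proj_mem_vertices hz) (hnot w hw hwK)
    (hnot z hz hzK) (by
      rintro _ ⟨k, hk, rfl⟩
      rw [hproj k (Or.inr hk), hproj w (Or.inl rfl)])
    ⟨_, hc.proj_mem hx hx', by
      rw [hproj w (Or.inl rfl), apply_proj]
      have := mul_ne_zero (inv_ne_zero (hc.pos hx hx').ne') (sub_ne_zero.2 hxu)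
      intro he
      exact this (by linarith)⟩
  have key : ∀ q, (restrict (edgeGraph (vertexFigure P l u)) (proj l u '' K)ᶜ).Reachable
      (proj l u w) q → ∀ y, (edgeGraph P).Adj u y → proj l u y = q →
      (restrict (link P u) Kᶜ).Reachable w y := by
    intro q hq
    rw [SimpleGraph.reachable_iff_reflTransGen] at hq
    induction hq with
    | refl =>
      intro y hy he
      rw [hc.proj_injOn (hc.mem_of_adj hy) (hc.mem_of_adj hw) he]
    | tail _ hab ih =>
      rintro y hy rfl
      obtain ⟨v, hv, rfl⟩ := hc.exists_proj_eq
        ((isPolytope_vertexFigure hP).mem_vertices_of_adj hab.1)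
      obtain ⟨F, hF, huF, hvF, hyF, -, hFN⟩ := hc.exists_isFace_of_adj hv hy hab.1
      exact (ih v hv rfl).trans (SimpleGraph.Adj.reachable
        ⟨⟨fun e => hab.1.ne (e ▸ rfl), hv, hy, F, hF, huF, hvF, hyF, hFN⟩,
          fun h => hab.2.1 ⟨v, h, rfl⟩, fun h => hab.2.2 ⟨y, h, rfl⟩⟩)
  exact key _ hr z hz rfl

end VertexFigure

/-! ### Sides of an edge of a forest -/

section Forest

variable {V : Type*} {C : SimpleGraph V} {u v w a b : V}

/-- A graph is a forest if each vertex has at most one neighbour above it. -/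
theorem isAcyclic_of_injective_up (g : V → ℝ) (hne : ∀ v a, C.Adj v a → g v ≠ g a)
    (hup : ∀ v a b, C.Adj v a → C.Adj v b → g v < g a → g v < g b → a = b) : C.IsAcyclic := by
  classical
  intro v c hc
  -- Both neighbours along the cycle of its lowest vertex lie above that vertex.
  obtain ⟨m, hm, hmin⟩ := c.support.toFinset.exists_min_image g ⟨v, by simp⟩
  rw [List.mem_toFinset] at hm
  have hc' := hc.rotate hm
  have hsup : ∀ x ∈ (c.rotate m hm).support, g m ≤ g x := fun x hx =>
    hmin x (by simpa using hx)
  have h1 := (c.rotate m hm).adj_snd hc'.not_nil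
  have h2 := ((c.rotate m hm).adj_penultimate hc'.not_nil).symm
  refine hc'.snd_ne_penultimate (hup m _ _ h1 h2 ?_ ?_)
  · exact lt_of_le_of_ne (hsup _ (SimpleGraph.Walk.getVert_mem_support _ _)) (hne _ _ h1)
  · exact lt_of_le_of_ne (hsup _ (SimpleGraph.Walk.getVert_mem_support _ _)) (hne _ _ h2)

/-- The vertices on the side of `u` after deleting the edge `uv`. -/
def side (C : SimpleGraph V) (u v : V) : Set V :=
  {x | (C.deleteEdges {s(u, v)}).Reachable u x}

theorem mem_side_self : u ∈ side C u v := SimpleGraph.Reachable.refl _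

theorem mem_side_of_adj (ha : a ∈ side C u v) (hab : C.Adj a b) (hne : s(a, b) ≠ s(u, v)) :
    b ∈ side C u v :=
  SimpleGraph.Reachable.trans ha (SimpleGraph.Adj.reachable (by
    rw [SimpleGraph.deleteEdges_adj]
    exact ⟨hab, hne⟩))

@[elab_as_elim]
theorem side_induction {p : ∀ x, x ∈ side C u v → Prop} (hu : p u mem_side_self)
    (hstep : ∀ a b (ha : a ∈ side C u v) (hab : C.Adj a b) (hne : s(a, b) ≠ s(u, v)),
      p a ha → p b (mem_side_of_adj ha hab hne)) {x : V} (hx : x ∈ side C u v) : p x hx := by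
  have hx' := hx
  change (C.deleteEdges {s(u, v)}).Reachable u x at hx'
  rw [SimpleGraph.reachable_iff_reflTransGen] at hx'
  induction hx' with
  | refl => exact hu
  | tail hr hab ih =>
    rw [← SimpleGraph.reachable_iff_reflTransGen] at hr
    rw [SimpleGraph.deleteEdges_adj] at hab
    exact hstep _ _ hr hab.1 hab.2 (ih hr)

theorem eq_of_adj_of_notMem_side (ha : a ∈ side C u v) (hab : C.Adj a b) (hb : b ∉ side C u v) :
    a = u ∧ b = v := by
  have : s(a, b) = s(u, v) := by
    by_contra hne
    exact hb (mem_side_of_adj ha hab hne)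
  rw [Sym2.eq_iff] at this
  rcases this with h | ⟨-, rfl⟩
  · exact h
  · exact absurd mem_side_self hb

theorem exists_mem_side {x : V} (hx : x ∈ side C u v) (hxu : x ≠ u) :
    ∃ w, C.Adj u w ∧ w ≠ v ∧ x ∈ side C w u := by
  have : x = u ∨ ∃ w, C.Adj u w ∧ w ≠ v ∧ x ∈ side C w u := by
    clear hxu
    induction hx using side_induction with
    | hu => exact Or.inl rfl
    | hstep a b _ hab hne ih =>
      rcases ih with rfl | ⟨w, hw, hwv, haw⟩
      · exact Or.inr ⟨b, hab, fun h => hne (h ▸ rfl), mem_side_self⟩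
      · by_cases hb : b ∈ side C w u
        · exact Or.inr ⟨w, hw, hwv, hb⟩
        · exact Or.inl (eq_of_adj_of_notMem_side haw hab hb).2
  exact this.resolve_left hxu

/-- A walk between different sides at `u` passes through `u`. -/
theorem mem_of_reachable_side {F : Set V} {x y : V}
    (hx : x ∈ side C v u) (hy : y ∉ side C v u) (h : (restrict C F).Reachable x y) :
    u ∈ F ∧ v ∈ F := by
  rw [SimpleGraph.reachable_iff_reflTransGen] at h
  induction h with
  | refl => exact absurd hx hy
  | @tail a b _ hab ih =>
    by_cases ha : a ∈ side C v u
    · obtain ⟨rfl, rfl⟩ := eq_of_adj_of_notMem_side ha hab.1 hy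
      exact ⟨hab.2.2, hab.2.1⟩
    · exact ih ha

theorem notMem_side (hC : C.IsAcyclic) (h : C.Adj u v) : v ∉ side C u v := by
  have := SimpleGraph.isAcyclic_iff_forall_adj_isBridge.1 hC h
  rw [SimpleGraph.isBridge_iff] at this
  exact this

theorem disjoint_side (hC : C.IsAcyclic) (hv : C.Adj u v) (hw : C.Adj u w) (hvw : v ≠ w) :
    Disjoint (side C v u) (side C w u) := by
  rw [Set.disjoint_right]
  intro x hx
  induction hx using side_induction with
  | hu => exact fun h => hvw (eq_of_adj_of_notMem_side h hw.symm (notMem_side hC hv.symm)).1.symm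
  | hstep a b ha hab _ hav =>
    intro hb
    obtain ⟨-, rfl⟩ := eq_of_adj_of_notMem_side hb hab.symm hav
    exact notMem_side hC hw.symm ha

theorem side_subset (hC : C.IsAcyclic) (hv : C.Adj u v) (hw : C.Adj u w) (hvw : w ≠ v) :
    side C w u ⊆ side C u v := by
  intro x hx
  induction hx using side_induction with
  | hu =>
    refine mem_side_of_adj mem_side_self hw fun h => ?_
    rw [Sym2.eq_iff] at h
    rcases h with ⟨-, h⟩ | ⟨h, -⟩
    · exact hvw h
    · exact hv.ne h
  | hstep a b ha hab _ hau =>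
    by_contra hb
    obtain ⟨rfl, -⟩ := eq_of_adj_of_notMem_side hau hab hb
    exact notMem_side hC hw.symm ha

end Forest

section Canopy

variable {E : Type*} [NormedAddCommGroup E] [InnerProductSpace ℝ E] {P B F : Set E} {u : E}

/-! ### The canopy of a treetope -/

/-- The canopy, as a graph on the ambient space. -/
def canopyGraph (P B : Set E) : SimpleGraph E where
  Adj x y := (edgeGraph P).Adj x y ∧ (x ∉ B ∨ y ∉ B)
  symm := ⟨fun _ _ h => ⟨h.1.symm, h.2.symm⟩⟩
  loopless := ⟨fun _ h => h.1.ne rfl⟩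

/-- Two neighbours of `x` above `x` give rise to a face with at least three vertices whose lowest
point is `x`. -/
theorem IsPolytope.exists_isFace_of_two_adj (hP : IsPolytope P) (h : E →L[ℝ] ℝ) {x a b : E}
    (ha : (edgeGraph P).Adj x a) (hb : (edgeGraph P).Adj x b) (hab : a ≠ b) (hxa : h x < h a)
    (hxb : h x < h b) :
    ∃ F, IsFace P F ∧ x ∈ F ∧ (∀ y ∈ F, y ≠ x → h x < h y) ∧ ∃ y z, (edgeGraph P).Adj x y ∧
      (edgeGraph P).Adj x z ∧ y ≠ z ∧ y ∈ F ∧ z ∈ F := by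
  obtain ⟨l, hc⟩ := hP.exists_isCut (hP.mem_vertices_of_adj ha)
  have hpos : ∀ w ∈ P, w ≠ x → (h x < h (proj l x w) ↔ h x < h w) := by
    intro w hw hwx
    have := inv_pos.2 (hc.pos hw hwx)
    rw [apply_proj]
    constructor
    · intro h1
      by_contra h2
      nlinarith
    · intro h1
      nlinarith [mul_pos this (sub_pos.2 h1)]
  have ha' := hc.mem_of_adj ha
  have hb' := hc.mem_of_adj hb
  have hpa := (hpos a (vertices_subset ha'.1) ha'.2).2 hxa
  have hpb := (hpos b (vertices_subset hb'.1) hb'.2).2 hxb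
  -- The first edge of a path in the part of the vertex figure above `x` gives the face; since that
  -- edge lies above `x`, so does the rest of the face.
  have hr := (isPolytope_vertexFigure (l := l) (u := x) hP).reachable_of_le h
    (H := restrict (edgeGraph (vertexFigure P l x)) {y | h x < h y})
    (hc.proj_mem_vertices ha) (hc.proj_mem_vertices hb) hpa.le hpb.le
    ⟨_, hc.proj_mem (vertices_subset ha'.1) ha'.2, hpa⟩ (by
      rintro p q hpq hp hq
      refine ⟨hpq, ?_, hq⟩
      rcases hp with rfl | rfl | hp
      exacts [hpa, hpb, hp])
  obtain ⟨q, hq⟩ : ∃ q, (restrict (edgeGraph (vertexFigure P l x)) {y | h x < h y}).Adj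
      (proj l x a) q := by
    obtain ⟨p⟩ := hr
    generalize hs : proj l x a = s at p
    generalize ht : proj l x b = t at p
    cases p with
    | nil => exact absurd (hc.proj_injOn ha' hb' (hs.trans ht.symm)) hab
    | cons hadj _ => exact ⟨_, hadj⟩
  obtain ⟨z, hz, rfl⟩ := hc.exists_proj_eq
    ((isPolytope_vertexFigure hP).mem_vertices_of_adj hq.1.symm)
  obtain ⟨F, hF, hxF, haF, hzF, hFe, -⟩ := hc.exists_isFace_of_adj ha hz hq.1
  refine ⟨F, hF, hxF, fun y hy hyx => ?_, a, z, ha, hz, fun e => hq.1.ne (e ▸ rfl), haF, hzF⟩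
  have h1 : proj l x y ∈ segment ℝ (proj l x a) (proj l x z) :=
    hFe ▸ ⟨hc.proj_mem_face hF hxF hy hyx, hc.proj_mem (hF.subset hy) hyx⟩
  exact (hpos y (hF.subset hy) hyx).1 ((convex_halfSpace_gt h.toLinearMap.isLinear
    (h x)).segment_subset hq.2.1 hq.2.2 h1)

theorem exists_injOn_functional [FiniteDimensional ℝ E] {s : Set E} (hs : s.Finite) :
    ∃ h : E →L[ℝ] ℝ, InjOn h s := by
  have := (hs.offDiag).to_subtype
  obtain ⟨h, hh⟩ := Module.exists_dual_forall_apply_ne_zero (K := ℝ)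
    (fun p : s.offDiag => p.1.1 - p.1.2) fun p => sub_ne_zero.2 p.2.2.2
  refine ⟨LinearMap.toContinuousLinearMap h, fun x hx y hy hxy => ?_⟩
  by_contra hne
  refine hh ⟨(x, y), hx, hy, hne⟩ ?_
  rw [map_sub, sub_eq_zero]
  exact hxy

namespace IsTreetope

theorem isFace (hP : IsTreetope P B) : IsFace P B := hP.isFacet.1

theorem not_subset (hP : IsTreetope P B) : ¬ P ⊆ B := fun h => by
  have h1 := hP.isFacet.2
  rw [hP.isFace.subset.antisymm h] at h1
  omega

theorem exists_functional (hP : IsTreetope P B) (hB : B.Nonempty) :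
    ∃ (f : E →L[ℝ] ℝ) (β : ℝ), (∀ y ∈ P, β ≤ f y) ∧ ∀ y ∈ P, y ∉ B ↔ β < f y := by
  obtain ⟨f, β, hf, hBe⟩ := hP.isFace.exists_eq_setOf hB
  refine ⟨-f, -β, fun y hy => by simpa using hf y hy, fun y hy => ?_⟩
  rw [hBe]
  have := hf y hy
  simp only [mem_ofPred_eq, hy, true_and, neg_apply, neg_lt_neg_iff]
  exact ⟨fun h => lt_of_le_of_ne this h, fun h => h.ne⟩

/-- Inside `F`, a path whose vertices other than its ends lie strictly above the level of `B` uses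
canopy edges only. -/
theorem canopy_reachable (hP : IsTreetope P B) (hB : B.Nonempty) (hF : IsFace P F)
    (hFB : ¬ F ⊆ B) {x y : E} (hx : x ∈ vertices P) (hy : y ∈ vertices P) (hxF : x ∈ F)
    (hyF : y ∈ F) : (restrict (canopyGraph P B) F).Reachable x y := by
  obtain ⟨f, β, hf, hfB⟩ := hP.exists_functional hB
  obtain ⟨z, hz, hzB⟩ := not_subset_iff_exists_mem_notMem.1 hFB
  refine (hP.isPolytope.isPolytope_of_isFace hF).reachable_of_le f (c := β)
    (by rw [hP.isPolytope.vertices_of_isFace hF]; exact ⟨hxF, hx⟩)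
    (by rw [hP.isPolytope.vertices_of_isFace hF]; exact ⟨hyF, hy⟩)
    (hf x (vertices_subset hx)) (hf y (vertices_subset hy))
    ⟨z, hz, (hfB z (hF.subset hz)).1 hzB⟩ fun a b hab _ hb => ?_
  obtain ⟨hab, ha, hb'⟩ := (hP.isPolytope.edgeGraph_adj_face hF).1 hab
  exact ⟨⟨hab, Or.inr ((hfB b (hF.subset hb')).2 hb)⟩, ha, hb'⟩

variable [FiniteDimensional ℝ E]

/-- Three vertices are never collinear, so the face has dimension at least two. -/
theorem not_subsingleton (hP : IsTreetope P B) (hF : IsFace P F) {x y z : E}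
    (hx : x ∈ vertices P) (hy : y ∈ vertices P) (hz : z ∈ vertices P) (hxy : x ≠ y) (hxz : x ≠ z)
    (hyz : y ≠ z) (hxF : x ∈ F) (hyF : y ∈ F) (hzF : z ∈ F) : ¬ (F ∩ B).Subsingleton := by
  intro hs
  have hdim := hP.dim_le_one F hF hs
  rw [dim, if_pos ⟨x, hxF⟩, direction_affineSpan] at hdim
  have hcol : Collinear ℝ F := collinear_iff_finrank_le_one.2 (by exact_mod_cast hdim)
  have hcol' : Collinear ℝ {x, y, z} := hcol.subset (by
    rintro w (rfl | rfl | rfl) <;> assumption)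
  rcases hcol'.wbtw_or_wbtw_or_wbtw with h | h | h
  · rcases hP.isPolytope.eq_or_eq_of_mem_segment hy (vertices_subset hx) (vertices_subset hz)
      h.mem_segment with h | h
    exacts [hxy h.symm, hyz h]
  · rcases hP.isPolytope.eq_or_eq_of_mem_segment hz (vertices_subset hy) (vertices_subset hx)
      h.mem_segment with h | h
    exacts [hyz h.symm, hxz h.symm]
  · rcases hP.isPolytope.eq_or_eq_of_mem_segment hx (vertices_subset hz) (vertices_subset hy)
      h.mem_segment with h | h
    exacts [hxz h, hxy h]

theorem exists_ne_mem_base (hP : IsTreetope P B) (h : E →L[ℝ] ℝ) {x a b : E}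
    (ha : (edgeGraph P).Adj x a) (hb : (edgeGraph P).Adj x b) (hab : a ≠ b) (hxa : h x < h a)
    (hxb : h x < h b) : ∃ y ∈ vertices P, y ∈ B ∧ y ≠ x ∧ h x < h y := by
  obtain ⟨F, hF, hxF, hup, y, z, hy, hz, hyz, hyF, hzF⟩ :=
    hP.isPolytope.exists_isFace_of_two_adj h ha hb hab hxa hxb
  have hns := hP.not_subsingleton hF (hP.isPolytope.mem_vertices_of_adj hy)
    (hP.isPolytope.mem_vertices_of_adj hy.symm) (hP.isPolytope.mem_vertices_of_adj hz.symm)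
    hy.ne hz.ne hyz hxF hyF hzF
  have hFB := hF.inter hP.isFace
  by_contra! hcon
  refine hns (subsingleton_of_subset_singleton (a := x) ?_)
  rw [← (hP.isPolytope.isPolytope_of_isFace hFB).convexHull_vertices,
    ← convexHull_singleton (𝕜 := ℝ) x, hP.isPolytope.vertices_of_isFace hFB]
  refine convexHull_mono fun w hw => ?_
  by_contra hwx
  exact absurd (hup w hw.1.1 hwx) (not_lt.2 (hcon w hw.2 hw.1.2 hwx))

theorem eq_of_canopy_adj (hP : IsTreetope P B) (hB : B.Nonempty) {x a b : E} (hx : x ∈ B)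
    (ha : (canopyGraph P B).Adj x a) (hb : (canopyGraph P B).Adj x b) : a = b := by
  by_contra hab
  obtain ⟨f, β, hf, hfB⟩ := hP.exists_functional hB
  have hle : f x ≤ β := not_lt.1 fun h => (hfB x (hP.isFace.subset hx)).2 h hx
  have key : ∀ c, (canopyGraph P B).Adj x c → f x < f c := fun c hc =>
    hle.trans_lt ((hfB c (vertices_subset (hP.isPolytope.mem_vertices_of_adj hc.1.symm))).1
      (hc.2.resolve_left (not_not.2 hx)))
  obtain ⟨y, hy, hyB, -, hlt⟩ := hP.exists_ne_mem_base f ha.1 hb.1 hab (key a ha) (key b hb)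
  exact (hfB y (vertices_subset hy)).2 (lt_of_le_of_lt (hf x (hP.isFace.subset hx)) hlt) hyB

theorem isAcyclic_canopyGraph (hP : IsTreetope P B) (hB : B.Nonempty) :
    (canopyGraph P B).IsAcyclic := by
  obtain ⟨f, β, hf, hfB⟩ := hP.exists_functional hB
  obtain ⟨h, hh⟩ := exists_injOn_functional hP.isPolytope.finite_vertices
  -- With `t` large, `t • f + h` refines the order of the vertices by `f`, and the generic `h`
  -- breaks ties. Base vertices thus stay below all others.
  obtain ⟨t, ht, htp⟩ := exists_pos_forall_lt_mul
    (hP.isPolytope.finite_vertices.prod hP.isPolytope.finite_vertices)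
    (fun p : E × E => f p.1 - f p.2) (fun p => h p.2 - h p.1)
  set g : E →L[ℝ] ℝ := t • f + h with hg
  have hge : ∀ x, g x = t * f x + h x := fun x => by simp [hg]
  have hlt : ∀ x ∈ vertices P, ∀ y ∈ vertices P, f x < f y → g x < g y := by
    intro x hx y hy hxy
    have : h x - h y < t * (f y - f x) := htp (y, x) ⟨hy, hx⟩ (sub_pos.2 hxy)
    rw [hge, hge]
    linarith
  have hinj : InjOn g (vertices P) := by
    intro x hx y hy hxy
    have hfe : f x = f y := by
      rcases lt_trichotomy (f x) (f y) with h1 | h1 | h1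
      · exact absurd hxy (hlt x hx y hy h1).ne
      · exact h1
      · exact absurd hxy (hlt y hy x hx h1).ne'
    rw [hge, hge, hfe] at hxy
    exact hh hx hy (add_left_cancel hxy)
  refine isAcyclic_of_injective_up g (fun v a hva he => hva.ne (hinj
    (hP.isPolytope.mem_vertices_of_adj hva.1) (hP.isPolytope.mem_vertices_of_adj hva.1.symm) he))
    fun v a b hva hvb hga hgb => ?_
  by_cases hv : v ∈ B
  · exact hP.eq_of_canopy_adj hB hv hva hvb
  by_contra hab
  obtain ⟨y, hy, hyB, -, hgy⟩ := hP.exists_ne_mem_base g hva.1 hvb.1 hab hga hgb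
  have hvP := hP.isPolytope.mem_vertices_of_adj hva.1
  have h1 := (hfB v (vertices_subset hvP)).1 hv
  have h2 : f y ≤ β := not_lt.1 fun h => (hfB y (vertices_subset hy)).2 h hyB
  exact lt_asymm hgy (hlt y hy v hvP (h2.trans_lt h1))

end IsTreetope

end Canopy

/-! ### Walks confined to a set of vertices -/

section Forest

variable {V : Type*} {C : SimpleGraph V} {u : V}

theorem exists_mem_side_of_reachable {F : Set V} {x : V} (h : (restrict C F).Reachable u x)
    (hxu : x ≠ u) : ∃ w, C.Adj u w ∧ w ∈ F ∧ x ∈ side C w u := by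
  have : x = u ∨ ∃ w, C.Adj u w ∧ w ∈ F ∧ x ∈ side C w u := by
    clear hxu
    rw [SimpleGraph.reachable_iff_reflTransGen] at h
    induction h with
    | refl => exact Or.inl rfl
    | @tail a b _ hab ih =>
      rcases ih with rfl | ⟨w, hw, hwF, haw⟩
      · exact Or.inr ⟨b, hab.1, hab.2.2, mem_side_self⟩
      · by_cases hb : b ∈ side C w u
        · exact Or.inr ⟨w, hw, hwF, hb⟩
        · exact Or.inl (eq_of_adj_of_notMem_side haw hab.1 hb).2
  exact this.resolve_left hxu

theorem encard_le_encard_sdiff_singleton_add_one (s : Set V) (a : V) :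
    s.encard ≤ (s \ {a}).encard + 1 := by
  rw [← tsub_le_iff_right]
  exact encard_tsub_one_le_encard_sdiff_singleton s a

theorem exists_adj_of_reachable {x y : V} {X : Set V} (h : C.Reachable x y) (hx : x ∈ X)
    (hy : y ∉ X) : ∃ a ∈ X, ∃ b ∉ X, C.Adj a b := by
  obtain ⟨p⟩ := h
  obtain ⟨d, -, h1, h2⟩ := p.exists_boundary_dart X hx hy
  exact ⟨_, h1, _, h2, d.adj⟩

end Forest

section Treetopes

variable {E : Type*} [NormedAddCommGroup E] [InnerProductSpace ℝ E] {P B : Set E} {u v w z : E}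

/-- A smaller link neighbourhood of `w` could be deleted without disconnecting the link, although it
separates `w` from some other neighbour of `u`. -/
theorem IsPolytope.encard_link_neighborSet [FiniteDimensional ℝ E]
    (hP : IsPolytope P) (hw : (edgeGraph P).Adj u w) :
    Module.finrank ℝ (vectorSpan ℝ P) ≤ ((link P u).neighborSet w).encard + 1 := by
  by_contra! hcon
  have hN := hP.encard_neighborSet (hP.mem_vertices_of_adj hw)
  obtain ⟨z, hz, hzR⟩ : ∃ z ∈ (edgeGraph P).neighborSet u,
      z ∉ insert w ((link P u).neighborSet w) := by
    by_contra! hsub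
    exact absurd ((encard_le_encard hsub).trans (encard_insert_le _ _))
      (not_le.2 (hcon.trans_le hN))
  rw [mem_insert_iff, not_or] at hzR
  have hr := hP.link_reachable_compl hcon (fun y hy => hy.2.2.1) hw hz (fun h => h.1 rfl) hzR.2
  obtain ⟨a, rfl, b, -, hab⟩ := exists_adj_of_reachable hr (mem_singleton w) hzR.1
  exact hab.2.2 hab.1

/-! ### The branches of a treetope and the graph of its base -/

namespace IsTreetope

theorem mem_vertices_of_mem_side (hP : IsTreetope P B) {x : E} (hu : u ∈ vertices P)
    (hx : x ∈ side (canopyGraph P B) u v) : x ∈ vertices P := by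
  induction hx using side_induction with
  | hu => exact hu
  | hstep a b _ hab _ _ => exact hP.isPolytope.mem_vertices_of_adj hab.1.symm

theorem finite_side (hP : IsTreetope P B) (hu : u ∈ vertices P) :
    (side (canopyGraph P B) u v).Finite :=
  hP.isPolytope.finite_vertices.subset fun _ hx => hP.mem_vertices_of_mem_side hu hx

variable [FiniteDimensional ℝ E]

/-- Base vertices are leaves of the canopy, so the two kinds of stem are both sides. -/
theorem side_subset_singleton (hP : IsTreetope P B) (hB : B.Nonempty)
    (hadj : (canopyGraph P B).Adj u w) (hw : w ∈ B) : side (canopyGraph P B) w u ⊆ {w} := by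
  intro x hx
  induction hx using side_induction with
  | hu => rfl
  | hstep a b _ hab hne ih =>
    rw [mem_singleton_iff] at ih
    rw [ih] at hab hne
    exact absurd (hP.eq_of_canopy_adj hB hw hab hadj.symm ▸ rfl) hne

/-- Take a face not inside `B` that meets `B` in the edge `xy`. Its canopy joins `x` to `y`, and in
a forest such a walk must run through `w`, `u` and `z`. -/
theorem exists_isFace_of_base_adj (hP : IsTreetope P B) (hB : B.Nonempty) (hu : u ∉ B)
    (hw : (edgeGraph P).Adj u w) (hz : (edgeGraph P).Adj u z) (hwz : w ≠ z) {x y : E}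
    (hx : x ∈ side (canopyGraph P B) w u) (hy : y ∈ side (canopyGraph P B) z u)
    (hxy : (edgeGraph B).Adj x y) :
    ∃ F, IsFace P F ∧ F ∩ B = segment ℝ x y ∧ u ∈ F ∧ w ∈ F ∧ z ∈ F := by
  have hC := hP.isAcyclic_canopyGraph hB
  have hw' : (canopyGraph P B).Adj u w := ⟨hw, Or.inl hu⟩
  have hz' : (canopyGraph P B).Adj u z := ⟨hz, Or.inl hu⟩
  have hdis := disjoint_side hC hw' hz' hwz
  obtain ⟨F, hF, hFB, hFn⟩ := hP.isPolytope.exists_isFace_inter_eq hP.isFace hP.not_subset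
    (hP.isPolytope.isFace_trans hP.isFace hxy.2) hxy.2.subset ⟨x, left_mem_segment ℝ x y⟩
  have hxF : x ∈ F ∩ B := hFB ▸ left_mem_segment ℝ x y
  have hyF : y ∈ F ∩ B := hFB ▸ right_mem_segment ℝ x y
  have hr := hP.canopy_reachable hB hF hFn
    (hP.mem_vertices_of_mem_side (hP.isPolytope.mem_vertices_of_adj hw.symm) hx)
    (hP.mem_vertices_of_mem_side (hP.isPolytope.mem_vertices_of_adj hz.symm) hy) hxF.1 hyF.1
  obtain ⟨huF, hwF⟩ := mem_of_reachable_side hx (disjoint_right.1 hdis hy) hr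
  exact ⟨F, hF, hFB, huF, hwF, (mem_of_reachable_side hy (disjoint_left.1 hdis hx) hr.symm).2⟩

theorem base_adj_unique (hP : IsTreetope P B) (hB : B.Nonempty) (hu : u ∉ B)
    (hw : (edgeGraph P).Adj u w) (hz : (edgeGraph P).Adj u z) (hwz : w ≠ z) {x y x' y' : E}
    (hx : x ∈ side (canopyGraph P B) w u) (hy : y ∈ side (canopyGraph P B) z u)
    (hx' : x' ∈ side (canopyGraph P B) w u) (hy' : y' ∈ side (canopyGraph P B) z u)
    (hxy : (edgeGraph B).Adj x y) (hxy' : (edgeGraph B).Adj x' y') : x = x' ∧ y = y' := by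
  have hPP := hP.isPolytope
  have hC := hP.isAcyclic_canopyGraph hB
  have hdis := disjoint_side hC (u := u) (v := w) (w := z) ⟨hw, Or.inl hu⟩ ⟨hz, Or.inl hu⟩ hwz
  obtain ⟨F, hF, hFB, huF, hwF, hzF⟩ :=
    hP.exists_isFace_of_base_adj hB hu hw hz hwz hx hy hxy
  obtain ⟨F', hF', hFB', huF', hwF', hzF'⟩ :=
    hP.exists_isFace_of_base_adj hB hu hw hz hwz hx' hy' hxy'
  have hns := hP.not_subsingleton (hF.inter hF') (hPP.mem_vertices_of_adj hw)
    (hPP.mem_vertices_of_adj hw.symm) (hPP.mem_vertices_of_adj hz.symm) hw.ne hz.ne hwz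
    ⟨huF, huF'⟩ ⟨hwF, hwF'⟩ ⟨hzF, hzF'⟩
  have hG := (hF.inter hF').inter hP.isFace
  have hGP := hPP.isPolytope_of_isFace hG
  have hG1 : F ∩ F' ∩ B ⊆ segment ℝ x y := fun q hq => hFB ▸ ⟨hq.1.1, hq.2⟩
  have hG2 : F ∩ F' ∩ B ⊆ segment ℝ x' y' := fun q hq => hFB' ▸ ⟨hq.1.2, hq.2⟩
  have hBv : ∀ {a b : E}, (edgeGraph B).Adj a b → a ∈ vertices P := fun hab =>
    hPP.mem_vertices_of_adj ((hPP.edgeGraph_adj_face hP.isFace).1 hab).1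
  have hvert : ∀ q ∈ vertices (F ∩ F' ∩ B), q = x ∨ q = y := fun q hq => by
    rw [hPP.vertices_of_isFace hG] at hq
    exact hPP.eq_or_eq_of_mem_segment hq.2 (vertices_subset (hBv hxy))
      (vertices_subset (hBv hxy.symm)) (hG1 hq.1)
  have hsing : ∀ a, ¬ vertices (F ∩ F' ∩ B) ⊆ {a} := fun a ha => hns (by
    rw [← hGP.convexHull_vertices]
    refine subsingleton_of_subset_singleton (a := a) ?_
    rw [← convexHull_singleton (𝕜 := ℝ) a]
    exact convexHull_mono ha)
  have hxG : x ∈ F ∩ F' ∩ B := by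
    by_contra hxG
    exact hsing y fun q hq => (hvert q hq).resolve_left fun e => hxG (e ▸ vertices_subset hq)
  have hyG : y ∈ F ∩ F' ∩ B := by
    by_contra hyG
    exact hsing x fun q hq => (hvert q hq).resolve_right fun e => hyG (e ▸ vertices_subset hq)
  have hx'P := vertices_subset (hBv hxy')
  have hy'P := vertices_subset (hBv hxy'.symm)
  constructor
  · exact (hPP.eq_or_eq_of_mem_segment (hBv hxy) hx'P hy'P (hG2 hxG)).resolve_right
      fun e => disjoint_left.1 hdis hx (e ▸ hy')
  · exact (hPP.eq_or_eq_of_mem_segment (hBv hxy.symm) hx'P hy'P (hG2 hyG)).resolve_left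
      fun e => disjoint_left.1 hdis hx' (e ▸ hy)

/-- The graph of the face behind the link edge stays connected without `u`, so an edge leaves the
side of `w` there, and it must be a base edge. Its far end is joined to `u` by the canopy of the
face through `w` or `z`, the only neighbours of `u` in it, and `w` is excluded. -/
theorem exists_base_adj_of_link (hP : IsTreetope P B) (hB : B.Nonempty) (hu : u ∉ B)
    (h : (link P u).Adj w z) : ∃ x ∈ side (canopyGraph P B) w u,
      ∃ y ∈ side (canopyGraph P B) z u, (edgeGraph B).Adj x y := by
  have hPP := hP.isPolytope
  have hC := hP.isAcyclic_canopyGraph hB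
  obtain ⟨hwz, hw, hz, F, hF, huF, hwF, hzF, hFN⟩ := h
  have hdis := disjoint_side hC (u := u) (v := w) (w := z) ⟨hw, Or.inl hu⟩ ⟨hz, Or.inl hu⟩ hwz
  have hFP := hPP.isPolytope_of_isFace hF
  have huv := hPP.mem_vertices_of_adj hw
  obtain ⟨l, hl⟩ := hPP.exists_lt_of_mem_vertices huv
  have hr : (restrict (edgeGraph F) {u}ᶜ).Reachable w z := by
    refine hFP.reachable_of_le (-l) (c := -l u)
      (by rw [hPP.vertices_of_isFace hF]; exact ⟨hwF, hPP.mem_vertices_of_adj hw.symm⟩)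
      (by rw [hPP.vertices_of_isFace hF]; exact ⟨hzF, hPP.mem_vertices_of_adj hz.symm⟩)
      (by simpa using (hl w (hF.subset hwF) hw.ne').le)
      (by simpa using (hl z (hF.subset hzF) hz.ne').le)
      ⟨w, hwF, by simpa using hl w (hF.subset hwF) hw.ne'⟩ fun a b hab ha hb => ⟨hab, ?_, ?_⟩
    · rintro rfl
      rcases ha with rfl | rfl | ha
      · exact hw.ne rfl
      · exact hz.ne rfl
      · exact lt_irrefl _ ha
    · rintro rfl
      exact lt_irrefl _ hb
  obtain ⟨a, ha, b, hb, hab⟩ := exists_adj_of_reachable hr mem_side_self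
    (disjoint_right.1 hdis mem_side_self)
  obtain ⟨habP, haF, hbF⟩ := (hPP.edgeGraph_adj_face hF).1 hab.1
  have habB : a ∈ B ∧ b ∈ B := by
    by_contra hcon
    rw [not_and_or] at hcon
    exact hab.2.2 (eq_of_adj_of_notMem_side ha ⟨habP, hcon⟩ hb).2
  refine ⟨a, ha, b, ?_, (hPP.edgeGraph_adj_face hP.isFace).2 ⟨habP, habB⟩⟩
  obtain ⟨y, hy, hyF, hby⟩ := exists_mem_side_of_reachable
    (hP.canopy_reachable hB hF (fun h => hu (h huF)) huv (hPP.mem_vertices_of_adj habP.symm)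
      huF hbF) hab.2.2
  rcases hFN y hyF hy.1 with rfl | rfl
  · exact absurd hby hb
  · exact hby

theorem side_inter_base_nonempty (hP : IsTreetope P B) (hB : B.Nonempty) (hu : u ∉ B)
    (hw : (edgeGraph P).Adj u w) (hd : 2 ≤ Module.finrank ℝ (vectorSpan ℝ P)) :
    (side (canopyGraph P B) w u ∩ B).Nonempty := by
  have h1 := hP.isPolytope.encard_link_neighborSet hw
  have h2 : ((link P u).neighborSet w).Nonempty := by
    by_contra hne
    rw [not_nonempty_iff_eq_empty] at hne
    rw [hne, encard_empty, zero_add] at h1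
    have : Module.finrank ℝ (vectorSpan ℝ P) ≤ 1 := by exact_mod_cast h1
    omega
  obtain ⟨z, hz⟩ := h2
  obtain ⟨x, hx, y, -, hxy⟩ := hP.exists_base_adj_of_link hB hu hz
  exact ⟨x, hx, hxy.2.subset (left_mem_segment ℝ x y)⟩

/-- Distinct base edges from a branch to its complement have distinct endpoints in the branch. -/
theorem base_adj_right_unique (hP : IsTreetope P B) (hB : B.Nonempty) (hu : u ∉ B) {j k : E}
    (hw : (edgeGraph P).Adj u w) (hj : (edgeGraph P).Adj u j) (hk : (edgeGraph P).Adj u k)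
    (hwB : w ∉ B) (hwj : w ≠ j) (hwk : w ≠ k) {a b c : E}
    (ha : a ∈ side (canopyGraph P B) w u) (hb : b ∈ side (canopyGraph P B) j u)
    (hc : c ∈ side (canopyGraph P B) k u) (hab : (edgeGraph B).Adj a b)
    (hac : (edgeGraph B).Adj a c) : b = c := by
  have hC := hP.isAcyclic_canopyGraph hB
  have hcan : ∀ {y}, (edgeGraph P).Adj u y → (canopyGraph P B).Adj u y := fun h => ⟨h, Or.inl hu⟩
  have haw : a ≠ w := by
    rintro rfl
    exact hwB (hab.2.subset (left_mem_segment ℝ a b))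
  -- Uniqueness is applied at `w` instead of `u`: `a` lies in a side at `w`, while `b` and `c` both
  -- lie in the side of `u`.
  obtain ⟨z, hz, hzu, haz⟩ := exists_mem_side ha haw
  exact (hP.base_adj_unique hB hwB hz.1 hw.symm hzu haz (side_subset hC (hcan hw) (hcan hj)
    hwj.symm hb) haz (side_subset hC (hcan hw) (hcan hk) hwk.symm hc) hab hac).2

/-- The case of a deleted supervertex: paths must stay inside the branch. The induction applies the
statement to the stems, which are smaller branches. -/
theorem reachable_side_sdiff (hP : IsTreetope P B) (hB : B.Nonempty) {K : Set E}
    (hK : K.encard + 2 < Module.finrank ℝ (vectorSpan ℝ P)) (hu : u ∉ B)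
    (hv : (edgeGraph P).Adj u v) {x y : E} (hx : x ∈ side (canopyGraph P B) u v) (hxB : x ∈ B)
    (hxK : x ∉ K) (hy : y ∈ side (canopyGraph P B) u v) (hyB : y ∈ B) (hyK : y ∉ K) :
    (restrict (edgeGraph B) (side (canopyGraph P B) u v \ K)).Reachable x y := by
  induction hn : (side (canopyGraph P B) u v).ncard using Nat.strong_induction_on
    generalizing u v x y with
  | _ n ih =>
  have hPP := hP.isPolytope
  have hC := hP.isAcyclic_canopyGraph hB
  have hcan : ∀ {y}, (edgeGraph P).Adj u y → (canopyGraph P B).Adj u y := fun h => ⟨h, Or.inl hu⟩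
  have hsub : ∀ {w}, (edgeGraph P).Adj u w → w ≠ v →
      side (canopyGraph P B) w u ⊆ side (canopyGraph P B) u v := fun hw hwv =>
    side_subset hC (hcan hv) (hcan hw) hwv
  set H := restrict (edgeGraph B) (side (canopyGraph P B) u v \ K) with hH
  have hstem : ∀ w, (edgeGraph P).Adj u w → w ≠ v → ∀ x ∈ side (canopyGraph P B) w u, x ∈ B →
      x ∉ K → ∀ y ∈ side (canopyGraph P B) w u, y ∈ B → y ∉ K → H.Reachable x y := by
    intro w hw hwv x hx hxB hxK y hy hyB hyK
    by_cases hwB : w ∈ B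
    · have h1 := hP.side_subset_singleton hB (hcan hw) hwB hx
      have h2 := hP.side_subset_singleton hB (hcan hw) hwB hy
      rw [mem_singleton_iff] at h1 h2
      rw [h1, h2]
    · refine (ih _ ?_ hwB hw.symm hx hxB hxK hy hyB hyK rfl).mono
        (restrict_mono le_rfl (sdiff_subset_sdiff_left (hsub hw hwv)))
      rw [← hn]
      exact ncard_lt_ncard ⟨hsub hw hwv, fun h => notMem_side hC (hcan hw).symm (h mem_side_self)⟩
        (hP.finite_side (hPP.mem_vertices_of_adj hv))
  set Z : Set E := {z | (edgeGraph P).Adj u z ∧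
    (z = v ∨ (side (canopyGraph P B) z u ∩ K).Nonempty)} with hZ
  -- The sides are disjoint, so `K` hits at most `K.encard` of them, and `v` adds one. The link
  -- therefore stays connected without `Z`.
  have hZK : Z.encard + 1 < Module.finrank ℝ (vectorSpan ℝ P) := by
    refine lt_of_le_of_lt ?_ hK
    have h1 : (Z \ {v}).encard ≤ K.encard := by
      have : ∀ z ∈ Z \ {v}, (side (canopyGraph P B) z u ∩ K).Nonempty := fun z hz =>
        hz.1.2.resolve_left hz.2
      choose! φ hφ using this
      refine encard_le_encard_of_injOn (f := φ) (fun z hz => (hφ z hz).2) fun z hz z' hz' he => ?_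
      by_contra hne
      exact disjoint_left.1 (disjoint_side hC (hcan hz.1.1) (hcan hz'.1.1) hne) (hφ z hz).1
        (he ▸ (hφ z' hz').1)
    calc Z.encard + 1 ≤ ((Z \ {v}).encard + 1) + 1 := by
          gcongr
          exact encard_le_encard_sdiff_singleton_add_one Z v
      _ ≤ K.encard + 1 + 1 := by gcongr
      _ = K.encard + 2 := by rw [add_assoc]; rfl
  have hunhit : ∀ w, (edgeGraph P).Adj u w → w ∉ Z → w ≠ v ∧ ∀ x ∈ side (canopyGraph P B) w u,
      x ∉ K := fun w hw hwZ =>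
    ⟨fun h => hwZ ⟨hw, Or.inl h⟩, fun x hx hxK => hwZ ⟨hw, Or.inr ⟨x, hx, hxK⟩⟩⟩
  have hmain : ∀ w, (edgeGraph P).Adj u w → w ∉ Z → ∀ z, (restrict (link P u) Zᶜ).Reachable w z →
      ∀ x ∈ side (canopyGraph P B) w u, x ∈ B → ∀ y ∈ side (canopyGraph P B) z u, y ∈ B →
      H.Reachable x y := by
    intro w hw hwZ z hr
    rw [SimpleGraph.reachable_iff_reflTransGen] at hr
    have hw' := hunhit w hw hwZ
    induction hr with
    | refl =>
      intro x hx hxB y hy hyB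
      exact hstem w hw hw'.1 x hx hxB (hw'.2 x hx) y hy hyB (hw'.2 y hy)
    | @tail a b _ hab ih' =>
      intro x hx hxB y hy hyB
      obtain ⟨p, hp, q, hq, hpq⟩ := hP.exists_base_adj_of_link hB hu hab.1
      have ha' := hunhit a hab.1.2.1 hab.2.1
      have hb' := hunhit b hab.1.2.2.1 hab.2.2
      have hqB := hpq.2.subset (right_mem_segment ℝ p q)
      refine (ih' x hx hxB p hp (hpq.2.subset (left_mem_segment ℝ p q))).trans (.trans
        (SimpleGraph.Adj.reachable ⟨hpq, ⟨hsub hab.1.2.1 ha'.1 hp, ha'.2 p hp⟩,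
          ⟨hsub hab.1.2.2.1 hb'.1 hq, hb'.2 q hq⟩⟩)
        (hstem b hab.1.2.2.1 hb'.1 q hq hqB (hb'.2 q hq) y hy hyB (hb'.2 y hy)))
  have hescape : ∀ x ∈ side (canopyGraph P B) u v, x ∈ B → x ∉ K → ∃ w, (edgeGraph P).Adj u w ∧
      w ∉ Z ∧ ∃ x' ∈ side (canopyGraph P B) w u, x' ∈ B ∧ H.Reachable x x' := by
    intro x hx hxB hxK
    obtain ⟨w, hw, hwv, hxw⟩ := exists_mem_side hx fun h => hu (h ▸ hxB)
    by_cases hwZ : w ∉ Z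
    · exact ⟨w, hw.1, hwZ, x, hxw, hxB, .refl _⟩
    rw [not_not] at hwZ
    -- A hit stem at a base vertex would be a single deleted vertex.
    have hwB : w ∉ B := by
      intro hwB
      obtain ⟨y, hyw, hyK⟩ := hwZ.2.resolve_left hwv
      have h1 := hP.side_subset_singleton hB hw hwB hxw
      have h2 := hP.side_subset_singleton hB hw hwB hyw
      rw [mem_singleton_iff] at h1 h2
      exact hxK (h1.trans h2.symm ▸ hyK)
    have hR : ∀ j ∈ (link P u).neighborSet w \ {v}, ∃ a b, a ∈ side (canopyGraph P B) w u ∧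
        b ∈ side (canopyGraph P B) j u ∧ (edgeGraph B).Adj a b := fun j hj => by
      obtain ⟨a, ha, b, hb, hab⟩ := hP.exists_base_adj_of_link hB hu hj.1
      exact ⟨a, b, ha, hb, hab⟩
    choose! a b ha hb hab using hR
    by_contra! hcon
    -- If `x` cannot escape, each link neighbour `j` of `w` is charged to a deleted vertex: the near
    -- end of its base edge, or a vertex in the side of `j`. Disjointness of sides and uniqueness of
    -- base edges at `w` make the charging injective, but `w` has more than `K.encard` such
    -- neighbours.
    have hφ : ∀ j ∈ (link P u).neighborSet w \ {v}, ∃ c ∈ K, c = a j ∨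
        c ∈ side (canopyGraph P B) j u := by
      intro j hj
      by_cases hajK : a j ∈ K
      · exact ⟨_, hajK, Or.inl rfl⟩
      by_cases hjZ : j ∈ Z
      · obtain ⟨c, hc, hcK⟩ := hjZ.2.resolve_left hj.2
        exact ⟨c, hcK, Or.inr hc⟩
      · have hj' := hunhit j hj.1.2.2.1 hjZ
        have hpq := hab j hj
        refine absurd ?_ (hcon j hj.1.2.2.1 hjZ (b j) (hb j hj)
          (hpq.2.subset (right_mem_segment ℝ _ _)))
        exact (hstem w hw.1 hwv x hxw hxB hxK (a j) (ha j hj)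
          (hpq.2.subset (left_mem_segment ℝ _ _)) hajK).trans (SimpleGraph.Adj.reachable
            ⟨hpq, ⟨hsub hw.1 hwv (ha j hj), hajK⟩, ⟨hsub hj.1.2.2.1 hj'.1 (hb j hj),
              hj'.2 _ (hb j hj)⟩⟩)
    choose! φ hφK hφ using hφ
    have hdw : ∀ j ∈ (link P u).neighborSet w \ {v},
        Disjoint (side (canopyGraph P B) w u) (side (canopyGraph P B) j u) := fun j hj =>
      disjoint_side hC hw (hcan hj.1.2.2.1) hj.1.1
    have hinj : InjOn φ ((link P u).neighborSet w \ {v}) := by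
      intro j hj k hk he
      by_contra hne
      have hdis := disjoint_side hC (hcan hj.1.2.2.1) (hcan hk.1.2.2.1) hne
      rcases hφ j hj with h1 | h1 <;> rcases hφ k hk with h2 | h2
      · have hak : a j = a k := h1.symm.trans (he.trans h2)
        have := hP.base_adj_right_unique hB hu hw.1 hj.1.2.2.1 hk.1.2.2.1 hwB hj.1.1 hk.1.1
          (ha j hj) (hb j hj) (hb k hk) (hab j hj) (hak ▸ hab k hk)
        exact disjoint_left.1 hdis (hb j hj) (this ▸ hb k hk)
      · exact disjoint_left.1 (hdw k hk) (ha j hj) (h1 ▸ he ▸ h2)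
      · exact disjoint_left.1 (hdw j hj) (ha k hk) (h2 ▸ he ▸ h1)
      · exact disjoint_left.1 hdis h1 (he ▸ h2)
    have hcard := encard_le_encard_of_injOn (f := φ) (fun j hj => hφK j hj) hinj
    refine absurd (hPP.encard_link_neighborSet hw.1) (not_le.2 (lt_of_le_of_lt ?_ hK))
    calc ((link P u).neighborSet w).encard + 1
        ≤ (((link P u).neighborSet w \ {v}).encard + 1) + 1 := by
          gcongr
          exact encard_le_encard_sdiff_singleton_add_one _ v
      _ ≤ K.encard + 1 + 1 := by gcongr
      _ = K.encard + 2 := by rw [add_assoc]; rfl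
  obtain ⟨w, hw, hwZ, x', hx', hx'B, hxr⟩ := hescape x hx hxB hxK
  obtain ⟨z, hz, hzZ, y', hy', hy'B, hyr⟩ := hescape y hy hyB hyK
  exact hxr.trans (.trans (hmain w hw hwZ z (hPP.link_reachable_compl hZK (fun _ h => h.1) hw hz
    hwZ hzZ) x' hx' hx'B y' hy' hy'B) hyr.symm)

end IsTreetope

end Treetopes

/-! ### Connectivity of a contracted graph -/

section Contraction

variable {W : Type*}

theorem collapse_of_mem {S : Set W} {x : W} (h : x ∈ S) : collapse S x = some x := if_pos h

theorem collapse_of_notMem {S : Set W} {x : W} (h : x ∉ S) : collapse S x = none := if_neg h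

/-- A walk through vertices with surviving images descends to the contraction; edges within a fibre
become stationary. -/
theorem connected_induce_contractOutside {G : SimpleGraph W} {S : Set W}
    {K : Set (range (collapse S))} (hne : Kᶜ.Nonempty)
    (h : ∀ x y, rangeFactorization (collapse S) x ∉ K → rangeFactorization (collapse S) y ∉ K →
      (restrict G {z | rangeFactorization (collapse S) z ∉ K}).Reachable x y) :
    ((contractOutside G S).induce Kᶜ).Connected := by
  set π := rangeFactorization (collapse S)
  have hπ : Function.Surjective π := rangeFactorization_surjective
  have key : ∀ x y, (restrict G {z | π z ∉ K}).Reachable x y → ∀ (hx : π x ∈ Kᶜ) (hy : π y ∈ Kᶜ),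
      ((contractOutside G S).induce Kᶜ).Reachable ⟨π x, hx⟩ ⟨π y, hy⟩ := by
    intro x y hr hx
    rw [SimpleGraph.reachable_iff_reflTransGen] at hr
    induction hr with
    | refl => exact fun _ => .refl _
    | @tail a b _ hab ih =>
      intro hb
      refine (ih hab.2.1).trans ?_
      by_cases he : π a = π b
      · have : (⟨π a, hab.2.1⟩ : (Kᶜ : Set _)) = ⟨π b, hb⟩ := Subtype.ext he
        rw [this]
      · exact SimpleGraph.Adj.reachable (SimpleGraph.map_adj_apply' (f := π) hab.1 he)
  have : Nonempty (Kᶜ : Set (range (collapse S))) := hne.to_subtype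
  refine ⟨fun ⟨p, hp⟩ ⟨q, hq⟩ => ?_⟩
  obtain ⟨x, rfl⟩ := hπ p
  obtain ⟨y, rfl⟩ := hπ q
  exact key x y (h x y hp hq) hp hq

end Contraction

/-! ### Branches, stems and external connectivity in terms of sides -/

section Treetopes

variable {E : Type*} [NormedAddCommGroup E] [InnerProductSpace ℝ E] {P B : Set E}

theorem graph_adj_iff {x y : vertices P} :
    (graph P).Adj x y ↔ (edgeGraph P).Adj (x : E) (y : E) :=
  and_congr_left' (not_congr Subtype.ext_iff)

theorem IsPolytope.reachable_of_reachable_coe (hP : IsPolytope P) {S : Set E}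
    {T : Set (vertices P)} (hST : ∀ z : vertices P, (z : E) ∈ S → z ∈ T) {x y : vertices P}
    (h : (restrict (edgeGraph P) S).Reachable (x : E) y) : (restrict (graph P) T).Reachable x y := by
  have key : ∀ q, (restrict (edgeGraph P) S).Reachable (x : E) q → ∀ y : vertices P, (y : E) = q →
      (restrict (graph P) T).Reachable x y := by
    intro q hq
    rw [SimpleGraph.reachable_iff_reflTransGen] at hq
    induction hq with
    | refl => exact fun y hy => Subtype.ext hy ▸ .refl _
    | @tail a b _ hab ih =>
      rintro y rfl
      exact (ih ⟨a, hP.mem_vertices_of_adj hab.1⟩ rfl).trans (SimpleGraph.Adj.reachable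
        ⟨graph_adj_iff.2 hab.1, hST _ hab.2.1, hST _ hab.2.2⟩)
  exact key _ h y rfl

namespace IsTreetope

theorem segment_inter_subsingleton_iff (hP : IsTreetope P B) {x y : E}
    (hxy : (edgeGraph P).Adj x y) : (segment ℝ x y ∩ B).Subsingleton ↔ x ∉ B ∨ y ∉ B := by
  have hPP := hP.isPolytope
  constructor
  · intro h
    by_contra! hcon
    exact hxy.ne (h ⟨left_mem_segment ℝ x y, hcon.1⟩ ⟨right_mem_segment ℝ x y, hcon.2⟩)
  · have key : ∀ {x y : E}, (edgeGraph P).Adj x y → x ∉ B → (segment ℝ x y ∩ B).Subsingleton := by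
      intro x y hxy hx
      have hG := hxy.2.inter hP.isFace
      refine subsingleton_of_subset_singleton (a := y) ?_
      rw [← (hPP.isPolytope_of_isFace hG).convexHull_vertices, ← convexHull_singleton (𝕜 := ℝ) y]
      refine convexHull_mono fun q hq => ?_
      rw [hPP.vertices_of_isFace hG] at hq
      exact (hPP.eq_or_eq_of_mem_segment hq.2
        (vertices_subset (hPP.mem_vertices_of_adj hxy))
        (vertices_subset (hPP.mem_vertices_of_adj hxy.symm)) hq.1.1).resolve_left
          fun e => hx (e ▸ hq.1.2)
    rintro (h | h)
    · exact key hxy h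
    · rw [segment_symm]
      exact key hxy.symm h

theorem canopy_adj_iff (hP : IsTreetope P B) {x y : vertices P} :
    (canopy P B).Adj x y ↔ (canopyGraph P B).Adj (x : E) (y : E) :=
  ⟨fun h => ⟨graph_adj_iff.1 h.1, (hP.segment_inter_subsingleton_iff (graph_adj_iff.1 h.1)).1 h.2⟩,
    fun h => ⟨graph_adj_iff.2 h.1, (hP.segment_inter_subsingleton_iff h.1).2 h.2⟩⟩

theorem branch_eq_side (hP : IsTreetope P B) (u v : vertices P) :
    branch P B u v = side (canopyGraph P B) (u : E) v := by
  have hs : ∀ a b : vertices P, s((a : E), (b : E)) = s((u : E), (v : E)) ↔ s(a, b) = s(u, v) := by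
    intro a b
    simp only [Sym2.eq_iff, Subtype.ext_iff]
  ext x
  constructor
  · rintro ⟨y, hy, rfl⟩
    change ((canopy P B).deleteEdges {s(u, v)}).Reachable u y at hy
    rw [SimpleGraph.reachable_iff_reflTransGen] at hy
    induction hy with
    | refl => exact mem_side_self
    | tail _ hab ih =>
      rw [SimpleGraph.deleteEdges_adj] at hab
      exact mem_side_of_adj ih (hP.canopy_adj_iff.1 hab.1) fun h => hab.2 ((hs _ _).1 h)
  · intro hx
    induction hx using side_induction with
    | hu => exact ⟨u, SimpleGraph.Reachable.refl _, rfl⟩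
    | hstep a b _ hab hne ih =>
      obtain ⟨a, ha, rfl⟩ := ih
      refine ⟨⟨b, hP.isPolytope.mem_vertices_of_adj hab.1.symm⟩,
        SimpleGraph.Reachable.trans ha (SimpleGraph.Adj.reachable ?_), rfl⟩
      rw [SimpleGraph.deleteEdges_adj]
      exact ⟨hP.canopy_adj_iff.2 hab, fun h => hne ((hs _ ⟨b, _⟩).2 h)⟩

theorem finrank_vectorSpan {d : ℕ} (hd : dim P = d) (hne : P.Nonempty) :
    Module.finrank ℝ (vectorSpan ℝ P) = d := by
  rw [dim, if_pos hne, direction_affineSpan] at hd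
  exact_mod_cast hd

variable [FiniteDimensional ℝ E]

/-- The empty set has dimension `-1`, so it is a facet only of a point. -/
theorem base_nonempty (hP : IsTreetope P B) {x y : E} (hxy : (edgeGraph P).Adj x y) :
    B.Nonempty := by
  by_contra hB
  have h1 := hP.isFacet.2
  have hx := hxy.2.subset (left_mem_segment ℝ x y)
  have hy := hxy.2.subset (right_mem_segment ℝ x y)
  rw [dim, if_neg hB] at h1
  have h2 : dim P = (0 : ℕ) := by push_cast; omega
  have h3 := finrank_vectorSpan h2 ⟨x, hx⟩
  rw [Submodule.finrank_eq_zero] at h3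
  have h4 := vsub_mem_vectorSpan ℝ hx hy
  rw [h3, Submodule.mem_bot, vsub_eq_sub, sub_eq_zero] at h4
  exact hxy.ne h4

variable {u v : vertices P}

theorem isStemAt_iff (hP : IsTreetope P B) (hB : B.Nonempty) (hu : (u : E) ∉ B) {w : vertices P}
    (hw : (graph P).Adj u w) {X : Set E} :
    IsStemAt P B u w X ↔ X = side (canopyGraph P B) (w : E) u := by
  rw [IsStemAt, hP.branch_eq_side]
  by_cases hwB : (w : E) ∈ B
  · have : side (canopyGraph P B) (w : E) u = {(w : E)} :=
      (hP.side_subset_singleton hB ⟨graph_adj_iff.1 hw, Or.inl hu⟩ hwB).antisymm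
        (singleton_subset_iff.2 mem_side_self)
    simp [hwB, this]
  · simp [hwB]

theorem stems_eq (hP : IsTreetope P B) (hB : B.Nonempty) (hu : (u : E) ∉ B) :
    stems P B u v = (fun w => side (canopyGraph P B) w (u : E)) ''
      ((edgeGraph P).neighborSet (u : E) \ {(v : E)}) := by
  ext X
  constructor
  · rintro ⟨w, hw, hwv, hX⟩
    exact ⟨w, ⟨graph_adj_iff.1 hw, fun h => hwv (Subtype.ext h)⟩,
      ((hP.isStemAt_iff hB hu hw).1 hX).symm⟩
  · rintro ⟨w, ⟨hw, hwv⟩, rfl⟩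
    have hw' : (graph P).Adj u ⟨w, hP.isPolytope.mem_vertices_of_adj hw.symm⟩ :=
      graph_adj_iff.2 hw
    exact ⟨_, hw', fun h => hwv (congrArg Subtype.val h), (hP.isStemAt_iff hB hu hw').2 rfl⟩

theorem le_ncard_stems (hP : IsTreetope P B) (hB : B.Nonempty) (hu : (u : E) ∉ B)
    (huv : (graph P).Adj u v) {d : ℕ} (hd : Module.finrank ℝ (vectorSpan ℝ P) = d) :
    d - 1 ≤ (stems P B u v).ncard := by
  have huv' := graph_adj_iff.1 huv
  have hfin : ((edgeGraph P).neighborSet (u : E)).Finite :=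
    hP.isPolytope.finite_vertices.subset fun w hw =>
      hP.isPolytope.mem_vertices_of_adj (SimpleGraph.Adj.symm hw)
  have h1 := hP.isPolytope.encard_neighborSet u.2
  rw [hd, ← hfin.cast_ncard_eq, Nat.cast_le] at h1
  have hmem : (v : E) ∈ (edgeGraph P).neighborSet (u : E) := huv'
  rw [hP.stems_eq hB hu, InjOn.ncard_image, ncard_sdiff_singleton_of_mem hmem]
  · omega
  · intro w hw z hz he
    by_contra hwz
    have hdis := disjoint_side (hP.isAcyclic_canopyGraph hB) (u := (u : E)) (v := w) (w := z)
      ⟨hw.1, Or.inl hu⟩ ⟨hz.1, Or.inl hu⟩ hwz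
    have he' : side (canopyGraph P B) w (u : E) = side (canopyGraph P B) z u := he
    exact disjoint_left.1 hdis mem_side_self (he' ▸ mem_side_self)

theorem encard_edgesBetween_le_one (hP : IsTreetope P B) (hB : B.Nonempty) (hu : (u : E) ∉ B)
    (huv : (graph P).Adj u v) {X Y : Set E} (hX : X ∈ stems P B u v ∪ {branch P B v u})
    (hY : Y ∈ stems P B u v ∪ {branch P B v u}) (hXY : X ≠ Y) :
    (edgesBetween B X Y).encard ≤ 1 := by
  have huv' := graph_adj_iff.1 huv
  have key : ∀ X ∈ stems P B u v ∪ {branch P B v u},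
      ∃ w, (edgeGraph P).Adj (u : E) w ∧ X = side (canopyGraph P B) w (u : E) := by
    rintro X (hX | hX)
    · rw [hP.stems_eq hB hu] at hX
      obtain ⟨w, hw, rfl⟩ := hX
      exact ⟨w, hw.1, rfl⟩
    · exact ⟨v, huv', hX.trans (hP.branch_eq_side v u)⟩
  obtain ⟨w, hw, rfl⟩ := key X hX
  obtain ⟨z, hz, rfl⟩ := key Y hY
  have hwz : w ≠ z := by
    rintro rfl
    exact hXY rfl
  rw [encard_le_one_iff]
  rintro _ _ ⟨h1, x, y, rfl, hx, hy⟩ ⟨h2, x', y', rfl, hx', hy'⟩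
  obtain ⟨h3, h4⟩ := hP.base_adj_unique hB hu hw hz hwz hx hy hx' hy'
    (graph_adj_iff.1 h1) (graph_adj_iff.1 h2)
  rw [Subtype.ext h3, Subtype.ext h4]

theorem isExternallyConnected (hP : IsTreetope P B) (hu : (u : E) ∉ B)
    (huv : (graph P).Adj u v) {d : ℕ} (hd : dim P = d) :
    IsExternallyConnected B (branch P B u v ∩ B) (d - 1) := by
  have hPP := hP.isPolytope
  have huv' := graph_adj_iff.1 huv
  have hB := hP.base_nonempty huv'
  have hBP := hPP.isPolytope_of_isFace hP.isFace
  have hC := hP.isAcyclic_canopyGraph hB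
  have hcan : ∀ {y}, (edgeGraph P).Adj (u : E) y → (canopyGraph P B).Adj (u : E) y :=
    fun h => ⟨h, Or.inl hu⟩
  have hdP := finrank_vectorSpan hd ⟨u, vertices_subset u.2⟩
  have hd1 : 1 ≤ d := by
    have h1 := hP.isFacet.2
    rw [dim, if_pos hB, hd] at h1
    omega
  have hdB : Module.finrank ℝ (vectorSpan ℝ B) = d - 1 :=
    finrank_vectorSpan (by rw [hP.isFacet.2, hd]; omega) hB
  rw [hP.branch_eq_side]
  set U := side (canopyGraph P B) (u : E) v with hU
  set S : Set (vertices B) := Subtype.val ⁻¹' (U ∩ B) with hS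
  have hmemS : ∀ x : vertices B, x ∈ S ↔ (x : E) ∈ U :=
    fun x => and_iff_left (vertices_subset x.2)
  set π := rangeFactorization (collapse S) with hπ
  have hπval : ∀ x, (π x : Option (vertices B)) = collapse S x := fun _ => rfl
  have hπS : ∀ {x y}, x ∈ S → π x = π y → x = y := by
    intro x y hx he
    have he' := congrArg Subtype.val he
    rw [hπval, hπval, collapse_of_mem hx] at he'
    by_cases hy : y ∈ S
    · rw [collapse_of_mem hy] at he'
      exact Option.some_injective _ he'
    · rw [collapse_of_notMem hy] at he'
      exact absurd he' (Option.some_ne_none _)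
  -- For `d ≥ 2`, choose a base vertex in each of the at least `d` sides at `u`. All but the one for
  -- `v` lie in `S`, so `collapse` keeps them distinct.
  have hcard : ((d - 1 : ℕ) : ℕ∞) < ENat.card (range (collapse S)) := by
    rcases Nat.lt_or_ge d 2 with hd2 | hd2
    · obtain ⟨b, hb⟩ := hBP.nonempty_vertices hB
      have : Nonempty (range (collapse S)) := ⟨π ⟨b, hb⟩⟩
      have h0 : d - 1 = 0 := by omega
      rw [h0, Nat.cast_zero, pos_iff_ne_zero, Ne, ENat.card_eq_zero_iff_empty, not_isEmpty_iff]
      exact this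
    · have hrep : ∀ w ∈ (edgeGraph P).neighborSet (u : E), ∃ b : vertices B,
          (b : E) ∈ side (canopyGraph P B) w (u : E) := by
        intro w hw
        obtain ⟨a, ha, haB⟩ := hP.side_inter_base_nonempty hB hu hw (hdP ▸ hd2)
        exact ⟨⟨a, by
          rw [hPP.vertices_of_isFace hP.isFace]
          exact ⟨haB, hP.mem_vertices_of_mem_side
            (hPP.mem_vertices_of_adj (SimpleGraph.Adj.symm hw)) ha⟩⟩, ha⟩
      have : Nonempty (vertices B) := (hBP.nonempty_vertices hB).to_subtype
      choose! r hr using hrep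
      have hrS : ∀ w ∈ (edgeGraph P).neighborSet (u : E), w ≠ v → r w ∈ S := fun w hw hwv =>
        (hmemS _).2 (side_subset hC (hcan huv') (hcan hw) hwv (hr w hw))
      have hrinj : ∀ w ∈ (edgeGraph P).neighborSet (u : E),
          ∀ z ∈ (edgeGraph P).neighborSet (u : E), r w = r z → w = z := by
        intro w hw z hz he
        by_contra hwz
        exact disjoint_left.1 (disjoint_side hC (hcan hw) (hcan hz) hwz) (hr w hw)
          (he ▸ hr z hz)
      have h1 := encard_le_encard_of_injOn (s := (edgeGraph P).neighborSet (u : E))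
        (t := (univ : Set (range (collapse S)))) (f := fun w => π (r w)) (fun _ _ => mem_univ _) (by
          intro w hw z hz he
          by_cases hwv : w = v
          · by_cases hzv : z = v
            · rw [hwv, hzv]
            · exact (hrinj z hz w hw (hπS (hrS z hz hzv) he.symm)).symm
          · exact hrinj w hw z hz (hπS (hrS w hw hwv) he))
      rw [encard_univ] at h1
      refine lt_of_lt_of_le ?_ ((hPP.encard_neighborSet u.2).trans h1)
      rw [hdP, Nat.cast_lt]
      omega
  refine ⟨hcard, fun K hK => connected_induce_contractOutside ?_ fun x y hx hy => ?_⟩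
  · by_contra hne
    rw [not_nonempty_iff_eq_empty, compl_empty_iff] at hne
    rw [hne, encard_univ] at hK
    exact lt_asymm hK hcard
  have hval : ∀ s : Set (vertices B), (Subtype.val '' s : Set E).encard = s.encard := fun s =>
    Subtype.val_injective.encard_image s
  -- If the supervertex is deleted, it uses up one of at most `d - 2` deletions, leaving at most `d
  -- - 3` inside the branch.
  by_cases hs : ∃ k ∈ K, (k : Option (vertices B)) = none
  · obtain ⟨k, hk, hkn⟩ := hs
    have hKS : ∀ z, π z ∉ K → z ∈ S := by
      intro z hz
      by_contra hzS
      have : π z = k := Subtype.ext ((hπval z).trans ((collapse_of_notMem hzS).trans hkn.symm))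
      exact hz (this ▸ hk)
    have h1 : (π ⁻¹' K ∩ S).encard ≤ (K \ {k}).encard := by
      refine encard_le_encard_of_injOn (f := π) (fun z hz => ⟨hz.1, fun h => ?_⟩)
        fun z hz z' _ he => hπS hz.2 he
      rw [mem_singleton_iff] at h
      have := congrArg Subtype.val h
      rw [hπval, collapse_of_mem hz.2, hkn] at this
      exact Option.some_ne_none _ this
    have h2 : (Subtype.val '' (π ⁻¹' K ∩ S) : Set E).encard + 2 <
        Module.finrank ℝ (vectorSpan ℝ P) := by
      rw [hval, hdP]
      have h3 := encard_sdiff_singleton_add_one hk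
      have hKfin : (K \ {k}).Finite := (finite_of_encard_le_coe hK.le).subset sdiff_subset
      rw [← h3, ← hKfin.cast_ncard_eq] at hK
      rw [← hKfin.cast_ncard_eq] at h1
      have h4 : (K \ {k}).ncard + 1 < d - 1 := by exact_mod_cast hK
      calc (π ⁻¹' K ∩ S).encard + 2 ≤ ((K \ {k}).ncard : ℕ∞) + 2 := by gcongr
        _ < d := by
          have : (K \ {k}).ncard + 2 < d := by omega
          exact_mod_cast this
    have hout : ∀ z : vertices B, π z ∉ K →
        (z : E) ∉ (Subtype.val '' (π ⁻¹' K ∩ S) : Set E) := by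
      rintro z hz ⟨z', hz', he⟩
      exact hz (Subtype.ext he ▸ hz'.1)
    refine hBP.reachable_of_reachable_coe (S := U \ (Subtype.val '' (π ⁻¹' K ∩ S))) ?_
      (hP.reachable_side_sdiff hB h2 hu huv' ((hmemS x).1 (hKS x hx)) (vertices_subset x.2)
        (hout x hx) ((hmemS y).1 (hKS y hy)) (vertices_subset y.2) (hout y hy))
    rintro z ⟨hzU, hz⟩
    exact fun hzK => hz ⟨z, ⟨hzK, (hmemS z).2 hzU⟩, rfl⟩
  -- Here every deleted vertex is a single vertex of `B`, and `B` has dimension `d - 1`.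
  · push Not at hs
    have hKS : ∀ z, π z ∈ K → z ∈ S := by
      intro z hz
      by_contra hzS
      exact hs _ hz ((hπval z).trans (collapse_of_notMem hzS))
    have h1 : (Subtype.val '' (π ⁻¹' K) : Set E).encard < Module.finrank ℝ (vectorSpan ℝ B) := by
      rw [hval, hdB]
      exact lt_of_le_of_lt (encard_le_encard_of_injOn (f := π) (fun z hz => hz)
        fun z hz z' _ he => hπS (hKS z hz) he) hK
    have hout : ∀ z : vertices B, π z ∉ K → (z : E) ∉ (Subtype.val '' (π ⁻¹' K) : Set E) := by
      rintro z hz ⟨z', hz', he⟩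
      exact hz (Subtype.ext he ▸ hz')
    refine hBP.reachable_of_reachable_coe (S := (Subtype.val '' (π ⁻¹' K))ᶜ) ?_
      (hBP.reachable_compl h1 x.2 y.2 (hout x hx) (hout y hy))
    exact fun z hz hzK => hz ⟨z, hzK, rfl⟩

end IsTreetope

end Treetopes

end Treetope

end

theorem mainTheorem4 {E : Type*} [NormedAddCommGroup E] [InnerProductSpace ℝ E]
    [FiniteDimensional ℝ E] (P B : Set E) (hP : Treetope.IsTreetope P B)
    (d : ℕ) (hd : Treetope.dim P = d)
    (u v : Treetope.vertices P) (U V : Set E) (hUV : Treetope.IsSlice P B u v U V) :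
    -- each of the two branches has at least `d - 1` stems
    (d - 1 ≤ (Treetope.stems P B u v).ncard ∧ d - 1 ≤ (Treetope.stems P B v u).ncard) ∧
    -- at most one base edge between two stems of `U`, or a stem of `U` and `V`; same for `V`
    (∀ X ∈ Treetope.stems P B u v ∪ {V}, ∀ Y ∈ Treetope.stems P B u v ∪ {V}, X ≠ Y →
      (Treetope.edgesBetween B X Y).encard ≤ 1) ∧
    (∀ X ∈ Treetope.stems P B v u ∪ {U}, ∀ Y ∈ Treetope.stems P B v u ∪ {U}, X ≠ Y →
      (Treetope.edgesBetween B X Y).encard ≤ 1) ∧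
    -- external connectivity of both parts of the base
    Treetope.IsExternallyConnected B (U ∩ B) (d - 1) ∧
    Treetope.IsExternallyConnected B (V ∩ B) (d - 1) := by
  obtain ⟨huv, hu, hv, rfl, rfl⟩ := hUV
  have hB := hP.base_nonempty (Treetope.graph_adj_iff.1 huv)
  have hdP := Treetope.IsTreetope.finrank_vectorSpan hd ⟨u, Treetope.vertices_subset u.2⟩
  exact ⟨⟨hP.le_ncard_stems hB hu huv hdP, hP.le_ncard_stems hB hv huv.symm hdP⟩,
    fun X hX Y hY hXY => hP.encard_edgesBetween_le_one hB hu huv hX hY hXY,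
    fun X hX Y hY hXY => hP.encard_edgesBetween_le_one hB hv huv.symm hX hY hXY,
    hP.isExternallyConnected hu huv hd, hP.isExternallyConnected hv huv.symm hd⟩
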